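/- Let $R$ be a commutative artinian ring, let $A$ be an artin $R$-algebra (an $R$-algebra that is finitely generated as an $R$-module), and let $d\geq 0$ be an integer. Write $A\text{-Mod}$ for the category of all (not necessarily finitely generated) left $A$-modules, and put $DA=\mathrm{Hom}_R(A,E)$, where $E$ is the minimal injective cogenerator of $R$, regarded as a left $A$-module by $(af)(x)=f(xa)$. The algebra $A$ is called $d$-Gorenstein if the regular module $A$ has injective dimension at most $d$ both as a left and as a right $A$-module. An acyclic complex $P^\bullet=(P^n)_{n\in\mathbb Z}$ of projective $A$-modules is totally acyclic if $\mathrm{Hom}_A(P^\bullet,Q)$ is acyclic for every projective $A$-module $Q$; an acyclic complex $I^\bullet=(I^n)_{n\in\mathbb Z}$ of injective $A$-modules is cototally acyclic if $\mathrm{Hom}_A(J,I^\bullet)$ is acyclic for every injective $A$-module $J$. Let $A\text{-GProj}$ be the class of modules isomorphic to the zeroth cocycle $Z^0(P^\bullet)$ of a totally acyclic complex, and $A\text{-GInj}$ the class of modules isomorphic to the zeroth coboundary $B^0(I^\bullet)$ of a cototally acyclic complex. Let $\Omega^d(A\text{-Mod})$ be the class of modules $K$ for which there is an exact sequence $0\to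 K\to P_{d-1}\to\cdots\to P_0\to M\to 0$ with all $P_i$ projective, and $\Omega^{-d}(A\text{-Mod})$ the class of modules $K$ for which there is an exact sequence $0\to M\to I^0\to\cdots\to I^{d-1}\to K\to 0$ with all $I^i$ injective (for $d=0$ both are $A\text{-Mod}$). Let $\mathcal P^{\leq d}$ and $\mathcal I^{\leq d}$ be the classes of $A$-modules of projective, respectively injective, dimension at most $d$. Then the following statements are equivalent: (1) the algebra $A$ is $d$-Gorenstein; (2) $A\text{-GProj}=\Omega^d(A\text{-Mod})$; (2') $A\text{-GInj}=\Omega^{-d}(A\text{-Mod})$. In this case, $$A\text{-GProj}=\{M\in A\text{-Mod} : \mathrm{Ext}^i_A(M,A)=0 \text{ for all } i\geq 1\},\qquad A\text{-GInj}=\{M\in A\text{-Mod} : \mathrm{Ext}^i_A(DA,M)=0\text{ for all } i\geq 1\},$$ and $(A\text{-GProj},\mathcal P^{\leq d})$ and $(\mathcal I^{\leq d},A\text{-GInj})$ are cotorsion pairs in $A\text{-Mod}$. Here a cotorsion pair is a pair $(\mathcal F,\mathcal C)$ of full additive subcategories, both closed under direct summands, such that $\mathrm{Ext}^1(F,C)=0$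 for all $F\in\mathcal F$, $C\in\mathcal C$, and such that every object $M$ fits into short exact sequences $0\to C\to F\to M\to 0$ and $0\to M\to C'\to F'\to 0$ with $F,F'\in\mathcal F$ and $C,C'\in\mathcal C$. -/

import Mathlib

open CategoryTheory

universe u v w

noncomputable section

namespace GorensteinArtin

/-! ### The minimal injective cogenerator of a commutative ring -/

section Hull

variable {R : Type u} [Ring R]

/-- `ι : M → E` is an injective envelope of `M`: `E` is injective, `ι` is a monomorphism, and every
submodule of `E` that meets the image of `ι` trivially is zero. -/
structure IsInjectiveHull {M E : Type u} [AddCommGroup M] [Module R M] [AddCommGroup E]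
    [Module R E] (ι : M →ₗ[R] E) : Prop where
  isInjective : Module.Injective R E
  mono : Function.Injective ι
  essential : ∀ N : Submodule R E, N ⊓ LinearMap.range ι = ⊥ → N = ⊥

theorem exists_injectiveHull (M : Type u) [AddCommGroup M] [Module R M] :
    ∃ (E : ModuleCat.{u} R) (ι : M →ₗ[R] E), IsInjectiveHull ι := by
  let J : ModuleCat.{u} R := Injective.under (ModuleCat.of R M)
  let j : M →ₗ[R] J := (Injective.ι (ModuleCat.of R M)).hom
  have hj : Function.Injective j := (ModuleCat.mono_iff_injective _).1 inferInstance
  have hJ : Module.Injective R J := Module.injective_module_of_injective_object R J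
    (inj := inferInstanceAs (CategoryTheory.Injective (Injective.under (ModuleCat.of R M))))
  let S : Set (Submodule R J) := {N | LinearMap.range j ≤ N ∧
    ∀ K : Submodule R J, K ≤ N → K ⊓ LinearMap.range j = ⊥ → K = ⊥}
  have hS0 : LinearMap.range j ∈ S := ⟨le_rfl, fun K hK h => by rwa [inf_eq_left.2 hK] at h⟩
  obtain ⟨N, -, hN⟩ := zorn_le_nonempty₀ S (fun c hc hchain y hy => by
    refine ⟨sSup c, ⟨(hc hy).1.trans (le_sSup hy), fun K hK h => ?_⟩, fun z hz => le_sSup hz⟩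
    rw [Submodule.eq_bot_iff]
    intro x hx
    obtain ⟨Ni, hNi, hxi⟩ :=
      (Submodule.mem_sSup_of_directed ⟨y, hy⟩ hchain.directedOn).1 (hK hx)
    have h1 := (hc hNi).2 (K ⊓ Ni) inf_le_right
      (le_bot_iff.1 ((inf_le_inf_right _ inf_le_left).trans h.le))
    have : x ∈ K ⊓ Ni := ⟨hx, hxi⟩
    rwa [h1, Submodule.mem_bot] at this) _ hS0
  obtain ⟨hNS, hNmax⟩ := hN
  obtain ⟨K, -, hK⟩ := zorn_le_nonempty₀ {K : Submodule R J | K ⊓ N = ⊥}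
    (fun c hc hchain y hy => by
      refine ⟨sSup c, ?_, fun z hz => le_sSup hz⟩
      change sSup c ⊓ N = ⊥
      rw [Submodule.eq_bot_iff]
      rintro x ⟨hx, hxN⟩
      obtain ⟨Ki, hKi, hxi⟩ := (Submodule.mem_sSup_of_directed ⟨y, hy⟩ hchain.directedOn).1 hx
      have h1 : Ki ⊓ N = ⊥ := hc hKi
      have : x ∈ Ki ⊓ N := ⟨hxi, hxN⟩
      rwa [h1, Submodule.mem_bot] at this) ⊥ (by simp)
  obtain ⟨hK0, hKmax⟩ := hK
  change K ⊓ N = ⊥ at hK0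
  let q : N →ₗ[R] (J ⧸ K) := K.mkQ ∘ₗ N.subtype
  have hq : Function.Injective q := by
    rw [← LinearMap.ker_eq_bot, Submodule.eq_bot_iff]
    intro x hx
    have hxK : (x : J) ∈ K := by simpa [q] using hx
    have : (x : J) ∈ K ⊓ N := ⟨hxK, x.2⟩
    rw [hK0, Submodule.mem_bot] at this
    exact Subtype.ext this
  obtain ⟨g, hg⟩ := hJ.out q hq N.subtype
  -- `N` is essential in `J ⧸ K`
  have hess : ∀ L : Submodule R (J ⧸ K), L ⊓ LinearMap.range q = ⊥ → L = ⊥ := by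
    intro L hL
    have h1 : L.comap K.mkQ ⊓ N = ⊥ := by
      rw [Submodule.eq_bot_iff]
      rintro x ⟨hx, hxN⟩
      have h2 : q ⟨x, hxN⟩ ∈ L ⊓ LinearMap.range q := ⟨hx, ⟨x, hxN⟩, rfl⟩
      rw [hL, Submodule.mem_bot] at h2
      have := hq (h2.trans (map_zero q).symm)
      exact congrArg Subtype.val this
    have h2 : K ≤ L.comap K.mkQ := Submodule.le_comap_mkQ K L
    have h3 := hKmax (y := L.comap K.mkQ) h1 h2
    rw [Submodule.eq_bot_iff]
    intro y hy
    obtain ⟨x, rfl⟩ := K.mkQ_surjective y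
    exact (Submodule.Quotient.mk_eq_zero K).2 (h3 hy)
  have hginj : LinearMap.ker g = ⊥ := hess _ (by
    rw [Submodule.eq_bot_iff]
    rintro _ ⟨hy, x, rfl⟩
    have : (x : J) = 0 := (hg x).symm.trans hy
    rw [show x = 0 from Subtype.ext this, map_zero])
  have hNg : N ≤ LinearMap.range g := fun x hx => ⟨q ⟨x, hx⟩, hg ⟨x, hx⟩⟩
  have hgN : LinearMap.range g ≤ N := hNmax (y := LinearMap.range g) ⟨hNS.1.trans hNg, by
    intro L hL h
    have h1 : L ⊓ N = ⊥ := hNS.2 _ inf_le_right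
      (le_bot_iff.1 ((inf_le_inf_right _ inf_le_left).trans h.le))
    have h2 : L.comap g = ⊥ := hess _ (by
      rw [Submodule.eq_bot_iff]
      rintro _ ⟨hy, x, rfl⟩
      have hy' : (x : J) ∈ L ⊓ N := ⟨by simpa [hg x] using hy, x.2⟩
      rw [h1, Submodule.mem_bot] at hy'
      rw [show x = 0 from Subtype.ext hy', map_zero])
    rw [Submodule.eq_bot_iff]
    intro x hx
    obtain ⟨y, rfl⟩ := hL hx
    have hy : y ∈ L.comap g := hx
    rw [h2, Submodule.mem_bot] at hy
    rw [hy, map_zero]⟩ hNg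
  let r : J →ₗ[R] N := (g ∘ₗ K.mkQ).codRestrict N (fun x => hgN ⟨_, rfl⟩)
  have hr : ∀ x : N, r x = x := fun x => Subtype.ext (hg x)
  refine ⟨ModuleCat.of R N, j.codRestrict N (fun x => hNS.1 ⟨x, rfl⟩), ⟨⟨?_⟩, ?_, ?_⟩⟩
  · intro X Y _ _ _ _ f hf k
    obtain ⟨h, hh⟩ := hJ.out f hf (N.subtype ∘ₗ k)
    exact ⟨r ∘ₗ h, fun x => by
      rw [LinearMap.comp_apply, hh]
      exact hr (k x)⟩
  · intro x y hxy
    exact hj (congrArg Subtype.val hxy)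
  · intro L hL
    change Submodule R N at L
    have h1 : L.map N.subtype = ⊥ := hNS.2 _ (Submodule.map_subtype_le N L) (by
      rw [Submodule.eq_bot_iff]
      rintro _ ⟨⟨x, hx, rfl⟩, m, hm⟩
      have h2 : x ∈ L ⊓ LinearMap.range (j.codRestrict N (fun x => hNS.1 ⟨x, rfl⟩)) :=
        ⟨hx, m, Subtype.ext hm⟩
      rw [show L ⊓ LinearMap.range (j.codRestrict N (fun x => hNS.1 ⟨x, rfl⟩)) = ⊥ from hL,
        Submodule.mem_bot] at h2
      rw [h2, map_zero])
    rw [Submodule.eq_bot_iff]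
    intro x hx
    exact Subtype.ext ((Submodule.eq_bot_iff _).1 h1 x ⟨x, hx, rfl⟩)

end Hull

section Cogenerator

variable (R : Type u) [CommRing R]

/-- Every nonzero element of every module is detected by a homomorphism to `E`. -/
def IsCogenerator (E : Type u) [AddCommGroup E] [Module R E] : Prop :=
  ∀ (M : Type u) [AddCommGroup M] [Module R M] (x : M), x ≠ 0 → ∃ f : M →ₗ[R] E, f x ≠ 0

/-- `E` is an injective cogenerator, and no proper submodule of `E` is one. -/
structure IsMinimalInjectiveCogenerator (E : Type u) [AddCommGroup E] [Module R E] : Prop where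
  isInjective : Module.Injective R E
  isCogenerator : IsCogenerator R E
  minimal : ∀ N : Submodule R E, Module.Injective R N → IsCogenerator R N → N = ⊤

/-- The direct sum of one copy of each simple `R`-module. -/
abbrev SimpleSum : Type u :=
  DirectSum (MaximalSpectrum R) fun 𝔪 => R ⧸ 𝔪.asIdeal

/-- The minimal injective cogenerator `E` of `R`: the injective envelope of the direct sum of
one copy of each simple `R`-module. -/
def minInjCogenerator : ModuleCat.{u} R :=
  (exists_injectiveHull (R := R) (SimpleSum R)).choose

/-- The inclusion of the simple modules in `E`. -/
def minInjCogeneratorι : SimpleSum R →ₗ[R] minInjCogenerator R :=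
  (exists_injectiveHull (R := R) (SimpleSum R)).choose_spec.choose

theorem isInjectiveHull_minInjCogeneratorι : IsInjectiveHull (minInjCogeneratorι R) :=
  (exists_injectiveHull (R := R) (SimpleSum R)).choose_spec.choose_spec

theorem isMinimalInjectiveCogenerator_minInjCogenerator :
    IsMinimalInjectiveCogenerator R (minInjCogenerator R) := by
  classical
  have hE := isInjectiveHull_minInjCogeneratorι R
  set ι := minInjCogeneratorι R
  refine ⟨hE.isInjective, ?_, ?_⟩
  · intro M _ _ x hx
    have hann : Ideal.torsionOf R M x ≠ ⊤ := by
      rwa [Ne, Ideal.torsionOf_eq_top_iff]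
    obtain ⟨𝔪, h𝔪, hle⟩ := Ideal.exists_le_maximal _ hann
    let e := Ideal.quotTorsionOfEquivSpanSingleton R M x
    let p : (R ⧸ Ideal.torsionOf R M x) →ₗ[R] (R ⧸ 𝔪) := Submodule.factor hle
    let i : (R ⧸ 𝔪) →ₗ[R] SimpleSum R :=
      DirectSum.lof R (MaximalSpectrum R) (fun 𝔪 => R ⧸ 𝔪.asIdeal) ⟨𝔪, h𝔪⟩
    have hi : Function.Injective i :=
      DirectSum.of_injective (β := fun 𝔪 : MaximalSpectrum R => R ⧸ 𝔪.asIdeal) ⟨𝔪, h𝔪⟩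
    obtain ⟨g, hg⟩ := hE.isInjective.out (Submodule.span R {x}).subtype
      (Submodule.subtype_injective _) (ι ∘ₗ i ∘ₗ p ∘ₗ e.symm.toLinearMap)
    refine ⟨g, fun h0 => ?_⟩
    have h1 := hg ⟨x, Submodule.mem_span_singleton_self x⟩
    have h2 : e (Submodule.Quotient.mk 1) = ⟨x, Submodule.mem_span_singleton_self x⟩ := by
      apply Subtype.ext
      simpa [e] using congrArg Subtype.val (Ideal.quotTorsionOfEquivSpanSingleton_apply_mk x (1 : R))
    rw [← h2] at h1
    have h3 : ι (i (p (Submodule.Quotient.mk 1))) = 0 := by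
      have h4 : g ((e (Submodule.Quotient.mk 1) : Submodule.span R {x}) : M) = 0 := by
        rw [h2]; exact h0
      have h5 := h1.symm.trans h4
      simpa using h5
    have h4 : p (Submodule.Quotient.mk 1) = 0 :=
      hi ((hE.mono (h3.trans (map_zero ι).symm)).trans (map_zero i).symm)
    exact h𝔪.ne_top ((Ideal.eq_top_iff_one _).2 ((Submodule.Quotient.mk_eq_zero 𝔪).1 h4))
  · intro N hNinj hNcog
    -- `N` contains every simple summand
    have hι : LinearMap.range ι ≤ N := by
      rintro _ ⟨s, rfl⟩
      induction s using DirectSum.induction_on with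
      | zero => simp
      | add x y hx hy => rw [map_add]; exact N.add_mem hx hy
      | of 𝔪 a =>
        have h𝔪 := 𝔪.isMaximal
        have : Nontrivial (R ⧸ 𝔪.asIdeal) := Ideal.Quotient.nontrivial_iff.2 h𝔪.ne_top
        obtain ⟨f, hf⟩ := hNcog (R ⧸ 𝔪.asIdeal) (1 : R ⧸ 𝔪.asIdeal) one_ne_zero
        let f' : (R ⧸ 𝔪.asIdeal) →ₗ[R] minInjCogenerator R := N.subtype ∘ₗ f
        have hne : LinearMap.range f' ⊓ LinearMap.range ι ≠ ⊥ := fun h => by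
          have h1 := hE.essential _ h
          rw [Submodule.eq_bot_iff] at h1
          exact hf (Subtype.ext (h1 _ ⟨1, rfl⟩))
        obtain ⟨y, ⟨⟨b, hb⟩, ⟨t, ht⟩⟩, hy0⟩ := Submodule.exists_mem_ne_zero_of_ne_bot hne
        have hyN : y ∈ N := by rw [← hb]; exact (f b).2
        have hkill : ∀ r ∈ 𝔪.asIdeal, r • t = 0 := fun r hr => by
          apply hE.mono
          rw [map_smul, ht, ← hb, ← map_smul, map_zero]
          have : r • b = 0 := by
            obtain ⟨b, rfl⟩ := Ideal.Quotient.mk_surjective b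
            rw [Algebra.smul_def]
            exact (congrArg (· * _) (Ideal.Quotient.eq_zero_iff_mem.2 hr)).trans (zero_mul _)
          rw [this, map_zero]
        have htc : ∀ 𝔫 : MaximalSpectrum R, 𝔫 ≠ 𝔪 → t 𝔫 = 0 := fun 𝔫 hn => by
          have h𝔫 := 𝔫.isMaximal
          have hnle : ¬ 𝔪.asIdeal ≤ 𝔫.asIdeal := fun hle =>
            hn (MaximalSpectrum.ext (h𝔪.eq_of_le h𝔫.ne_top hle).symm)
          obtain ⟨r, hr, hrn⟩ := Set.not_subset.1 hnle
          have h1 : r • t 𝔫 = 0 := by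
            rw [← DirectSum.smul_apply, hkill r hr]; rfl
          obtain ⟨c, hc⟩ := Ideal.Quotient.mk_surjective (t 𝔫)
          rw [← hc] at h1 ⊢
          rw [Ideal.Quotient.eq_zero_iff_mem]
          have h2 : Ideal.Quotient.mk 𝔫.asIdeal (r * c) = 0 := by
            rw [map_mul]; rw [Algebra.smul_def] at h1; exact h1
          rw [Ideal.Quotient.eq_zero_iff_mem] at h2
          exact (h𝔫.isPrime.mem_or_mem h2).resolve_left hrn
        have ht' : t = DirectSum.of (fun 𝔪 : MaximalSpectrum R => R ⧸ 𝔪.asIdeal) 𝔪 (t 𝔪) := by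
          refine DFinsupp.ext fun 𝔫 => ?_
          by_cases h : 𝔫 = 𝔪
          · subst h; exact (DirectSum.of_eq_same (β := fun 𝔪 : MaximalSpectrum R => R ⧸ 𝔪.asIdeal) _ _).symm
          · rw [show t 𝔫 = 0 from htc 𝔫 h]
            exact (DirectSum.of_eq_of_ne (β := fun 𝔪 : MaximalSpectrum R => R ⧸ 𝔪.asIdeal)
              _ _ _ h).symm
        have htm : t 𝔪 ≠ 0 := fun h => hy0 (by rw [← ht, ht', h, map_zero, map_zero])
        let _ := Ideal.Quotient.field 𝔪.asIdeal
        obtain ⟨c, hc⟩ := Ideal.Quotient.mk_surjective (a * (t 𝔪)⁻¹)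
        have hca : c • t 𝔪 = a := by
          rw [Algebra.smul_def]
          change Ideal.Quotient.mk 𝔪.asIdeal c * t 𝔪 = a
          rw [hc, mul_assoc, inv_mul_cancel₀ htm, mul_one]
        have hcs : DirectSum.of (fun 𝔪 : MaximalSpectrum R => R ⧸ 𝔪.asIdeal) 𝔪 a = c • t := by
          conv_rhs => rw [ht']
          rw [← hca]
          exact (DirectSum.lof R (MaximalSpectrum R) (fun 𝔪 => R ⧸ 𝔪.asIdeal) 𝔪).map_smul c _
        rw [hcs, map_smul, ht]
        exact N.smul_mem c hyN
    obtain ⟨r, hr⟩ := hNinj.out N.subtype N.subtype_injective LinearMap.id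
    have hker : LinearMap.ker r = ⊥ := hE.essential _ (by
      rw [Submodule.eq_bot_iff]
      rintro x ⟨hx, hxι⟩
      have h1 := hr ⟨x, hι hxι⟩
      exact congrArg Subtype.val (h1.symm.trans hx))
    rw [Submodule.eq_top_iff']
    intro x
    have h1 : r x = r (r x : minInjCogenerator R) := (hr (r x)).symm
    have h2 := LinearMap.ker_eq_bot.1 hker h1
    rw [h2]
    exact (r x).2

end Cogenerator

/-! ### Gorenstein homological algebra over a ring -/

/-- The left `A`-module `DA = Hom_R(A, E)`, with `(a • f) x = f (x * a)`. -/
def dualModule (R A : Type u) [CommRing R] [Ring A] [Algebra R A] : ModuleCat.{u} A :=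
  (ModuleCat.coextendScalars (algebraMap R A)).obj (minInjCogenerator R)

section Classes

variable (A : Type u) [Ring A]

/-- `A` has injective dimension at most `d` as a left and as a right module over itself. -/
def IsGorensteinLE (d : ℕ) : Prop :=
  HasInjectiveDimensionLE (ModuleCat.of A A) d ∧ HasInjectiveDimensionLE (ModuleCat.of Aᵐᵒᵖ A) d

variable {A}

/-- An acyclic complex of projective modules whose Hom complex `Hom(P, Q)` is acyclic for every
projective module `Q`. -/
structure IsTotallyAcyclic (P : CochainComplex (ModuleCat.{u} A) ℤ) : Prop where
  projective : ∀ n, Projective (P.X n)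
  acyclic : P.Acyclic
  hom_acyclic : ∀ Q : ModuleCat.{u} A, Projective Q →
    ∀ (n : ℤ) (f : P.X n ⟶ Q), P.d (n - 1) n ≫ f = 0 →
      ∃ g : P.X (n + 1) ⟶ Q, P.d n (n + 1) ≫ g = f

/-- An acyclic complex of injective modules whose Hom complex `Hom(J, I)` is acyclic for every
injective module `J`. -/
structure IsCototallyAcyclic (I : CochainComplex (ModuleCat.{u} A) ℤ) : Prop where
  injective : ∀ n, Injective (I.X n)
  acyclic : I.Acyclic
  hom_acyclic : ∀ J : ModuleCat.{u} A, Injective J →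
    ∀ (n : ℤ) (f : J ⟶ I.X n), f ≫ I.d n (n + 1) = 0 →
      ∃ g : J ⟶ I.X (n - 1), g ≫ I.d (n - 1) n = f

variable (A)

/-- Gorenstein-projective modules: zeroth cocycles of totally acyclic complexes. -/
def GProj : ObjectProperty (ModuleCat.{u} A) := fun M =>
  ∃ P : CochainComplex (ModuleCat.{u} A) ℤ, IsTotallyAcyclic P ∧
    Nonempty (M ≃ₗ[A] LinearMap.ker (P.d 0 1).hom)

/-- Gorenstein-injective modules: zeroth coboundaries of cototally acyclic complexes. -/
def GInj : ObjectProperty (ModuleCat.{u} A) := fun N =>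
  ∃ I : CochainComplex (ModuleCat.{u} A) ℤ, IsCototallyAcyclic I ∧
    Nonempty (N ≃ₗ[A] LinearMap.range (I.d (-1) 0).hom)

variable {A}

/-- `IsSyzygy d M K`: the module `K` is a `d`-th syzygy of `M`, i.e. there is an exact sequence
`0 → K → P_{d-1} → ⋯ → P_0 → M → 0` with all `P_i` projective. -/
def IsSyzygy : ℕ → ModuleCat.{u} A → ModuleCat.{u} A → Prop
  | 0, M, K => Nonempty (M ≅ K)
  | d + 1, M, K => ∃ S : ShortComplex (ModuleCat.{u} A), S.ShortExact ∧ Projective S.X₂ ∧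
      Nonempty (S.X₁ ≅ K) ∧ IsSyzygy d M S.X₃

/-- `IsCosyzygy d M K`: the module `K` is a `d`-th cosyzygy of `M`, i.e. there is an exact sequence
`0 → M → I^0 → ⋯ → I^{d-1} → K → 0` with all `I^i` injective. -/
def IsCosyzygy : ℕ → ModuleCat.{u} A → ModuleCat.{u} A → Prop
  | 0, M, K => Nonempty (M ≅ K)
  | d + 1, M, K => ∃ S : ShortComplex (ModuleCat.{u} A), S.ShortExact ∧ Injective S.X₂ ∧
      Nonempty (S.X₃ ≅ K) ∧ IsCosyzygy d M S.X₁

variable (A)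

/-- The class `Ω^d(A-Mod)` of all `d`-th syzygies. -/
def syzygies (d : ℕ) : ObjectProperty (ModuleCat.{u} A) := fun K => ∃ M, IsSyzygy d M K

/-- The class `Ω^{-d}(A-Mod)` of all `d`-th cosyzygies. -/
def cosyzygies (d : ℕ) : ObjectProperty (ModuleCat.{u} A) := fun K => ∃ M, IsCosyzygy d M K

/-- The modules of projective dimension at most `d`. -/
def projDimLE (d : ℕ) : ObjectProperty (ModuleCat.{u} A) := fun M => HasProjectiveDimensionLE M d

/-- The modules of injective dimension at most `d`. -/
def injDimLE (d : ℕ) : ObjectProperty (ModuleCat.{u} A) := fun M => HasInjectiveDimensionLE M d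

/-- The modules `M` with `Ext^i(M, T) = 0` for all `i ≥ 1`. -/
def leftPerp (T : ModuleCat.{u} A) : ObjectProperty (ModuleCat.{u} A) := fun M =>
  ∀ i : ℕ, 1 ≤ i → Subsingleton (Abelian.Ext M T i)

/-- The modules `M` with `Ext^i(T, M) = 0` for all `i ≥ 1`. -/
def rightPerp (T : ModuleCat.{u} A) : ObjectProperty (ModuleCat.{u} A) := fun M =>
  ∀ i : ℕ, 1 ≤ i → Subsingleton (Abelian.Ext T M i)

end Classes

/-- A (complete) cotorsion pair of full additive subcategories of an abelian category. -/
structure IsCotorsionPair {C : Type u} [Category.{v} C] [Abelian C] [HasExt.{w} C]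
    (F G : ObjectProperty C) : Prop where
  left_additive : F.IsClosedUnderFiniteProducts
  right_additive : G.IsClosedUnderFiniteProducts
  left_summand : F.IsStableUnderRetracts
  right_summand : G.IsStableUnderRetracts
  ext_eq_zero : ∀ X Y : C, F X → G Y → Subsingleton (Abelian.Ext X Y 1)
  left_approx : ∀ M : C, ∃ S : ShortComplex C, S.ShortExact ∧ G S.X₁ ∧ F S.X₂ ∧ Nonempty (S.X₃ ≅ M)
  right_approx : ∀ M : C, ∃ S : ShortComplex C, S.ShortExact ∧ Nonempty (S.X₁ ≅ M) ∧ G S.X₂ ∧ F S.X₃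

end GorensteinArtin

end

noncomputable section

namespace GorensteinArtin

section Shift

variable {C : Type u} [Category.{v} C] [Abelian C] [HasExt.{w} C]

open Abelian

theorem subsingleton_ext_X₁ {S : ShortComplex C} (hS : S.ShortExact) {Y : C} {i : ℕ}
    (h₂ : Subsingleton (Ext S.X₂ Y i)) (h₃ : Subsingleton (Ext S.X₃ Y (i + 1))) :
    Subsingleton (Ext S.X₁ Y i) := by
  refine subsingleton_of_forall_eq 0 fun x => ?_
  obtain ⟨y, rfl⟩ := Ext.contravariant_sequence_exact₁ hS Y x (add_comm 1 i)
    (Subsingleton.elim _ _)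
  rw [Subsingleton.elim y 0, Ext.comp_zero]

theorem subsingleton_ext_X₂ {S : ShortComplex C} (hS : S.ShortExact) {Y : C} {i : ℕ}
    (h₁ : Subsingleton (Ext S.X₁ Y i)) (h₃ : Subsingleton (Ext S.X₃ Y i)) :
    Subsingleton (Ext S.X₂ Y i) := by
  refine subsingleton_of_forall_eq 0 fun x => ?_
  obtain ⟨y, rfl⟩ := Ext.contravariant_sequence_exact₂ hS Y x (Subsingleton.elim _ _)
  rw [Subsingleton.elim y 0, Ext.comp_zero]

theorem subsingleton_ext_X₃ {S : ShortComplex C} (hS : S.ShortExact) {Y : C} {i : ℕ}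
    (h₁ : Subsingleton (Ext S.X₁ Y i)) (h₂ : Subsingleton (Ext S.X₂ Y (i + 1))) :
    Subsingleton (Ext S.X₃ Y (i + 1)) := by
  refine subsingleton_of_forall_eq 0 fun x => ?_
  obtain ⟨y, rfl⟩ := Ext.contravariant_sequence_exact₃ hS Y x (Subsingleton.elim _ _)
    (add_comm 1 i)
  rw [Subsingleton.elim y 0, Ext.comp_zero]

theorem subsingleton_ext_into_X₁ {S : ShortComplex C} (hS : S.ShortExact) {X : C} {i : ℕ}
    (h₂ : Subsingleton (Ext X S.X₂ (i + 1))) (h₃ : Subsingleton (Ext X S.X₃ i)) :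
    Subsingleton (Ext X S.X₁ (i + 1)) := by
  refine subsingleton_of_forall_eq 0 fun x => ?_
  obtain ⟨y, rfl⟩ := Ext.covariant_sequence_exact₁ X hS x (Subsingleton.elim _ _) rfl
  rw [Subsingleton.elim y 0, Ext.zero_comp]

theorem subsingleton_ext_into_X₂ {S : ShortComplex C} (hS : S.ShortExact) {X : C} {i : ℕ}
    (h₁ : Subsingleton (Ext X S.X₁ i)) (h₃ : Subsingleton (Ext X S.X₃ i)) :
    Subsingleton (Ext X S.X₂ i) := by
  refine subsingleton_of_forall_eq 0 fun x => ?_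
  obtain ⟨y, rfl⟩ := Ext.covariant_sequence_exact₂ X hS x (Subsingleton.elim _ _)
  rw [Subsingleton.elim y 0, Ext.zero_comp]

theorem subsingleton_ext_into_X₃ {S : ShortComplex C} (hS : S.ShortExact) {X : C} {i : ℕ}
    (h₁ : Subsingleton (Ext X S.X₁ (i + 1))) (h₂ : Subsingleton (Ext X S.X₂ i)) :
    Subsingleton (Ext X S.X₃ i) := by
  refine subsingleton_of_forall_eq 0 fun x => ?_
  obtain ⟨y, rfl⟩ := Ext.covariant_sequence_exact₃ X hS x rfl (Subsingleton.elim _ _)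
  rw [Subsingleton.elim y 0, Ext.zero_comp]

theorem subsingleton_ext_of_retract_left {X X' Y : C} (r : Retract X X') {i : ℕ}
    (h : Subsingleton (Ext X' Y i)) : Subsingleton (Ext X Y i) := by
  refine subsingleton_of_forall_eq 0 fun x => ?_
  rw [← x.mk₀_id_comp, ← r.retract, ← Ext.mk₀_comp_mk₀, Ext.comp_assoc_of_second_deg_zero,
    Subsingleton.elim ((Ext.mk₀ r.r).comp x (zero_add i)) 0, Ext.comp_zero]

theorem subsingleton_ext_of_retract_right {X Y Y' : C} (r : Retract Y Y') {i : ℕ}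
    (h : Subsingleton (Ext X Y' i)) : Subsingleton (Ext X Y i) := by
  refine subsingleton_of_forall_eq 0 fun x => ?_
  rw [← x.comp_mk₀_id, ← r.retract, ← Ext.mk₀_comp_mk₀, ← Ext.comp_assoc_of_second_deg_zero,
    Subsingleton.elim (x.comp (Ext.mk₀ r.i) (add_zero i)) 0, Ext.zero_comp]

theorem subsingleton_ext_of_projective (P Y : C) [Projective P] {i : ℕ} (hi : 1 ≤ i) :
    Subsingleton (Ext P Y i) := HasProjectiveDimensionLT.subsingleton P 1 i hi Y

theorem subsingleton_ext_of_injective (X J : C) [Injective J] {i : ℕ} (hi : 1 ≤ i) :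
    Subsingleton (Ext X J i) := HasInjectiveDimensionLT.subsingleton J 1 i hi X

/-- Dimension shifting in the first variable. -/
theorem subsingleton_ext_shift_left {S : ShortComplex C} (hS : S.ShortExact)
    (hP : Projective S.X₂) {Y : C} {i : ℕ} (hi : 1 ≤ i) :
    Subsingleton (Ext S.X₁ Y i) ↔ Subsingleton (Ext S.X₃ Y (i + 1)) :=
  ⟨fun h => subsingleton_ext_X₃ hS h (subsingleton_ext_of_projective _ _ (by omega)),
    fun h => subsingleton_ext_X₁ hS (subsingleton_ext_of_projective _ _ hi) h⟩

/-- Dimension shifting in the second variable. -/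
theorem subsingleton_ext_shift_right {S : ShortComplex C} (hS : S.ShortExact)
    (hJ : Injective S.X₂) {X : C} {i : ℕ} (hi : 1 ≤ i) :
    Subsingleton (Ext X S.X₃ i) ↔ Subsingleton (Ext X S.X₁ (i + 1)) :=
  ⟨fun h => subsingleton_ext_into_X₁ hS (subsingleton_ext_of_injective _ _ (by omega)) h,
    fun h => subsingleton_ext_into_X₃ hS h (subsingleton_ext_of_injective _ _ hi)⟩

theorem exists_extension_of_ext_one {S : ShortComplex C} (hS : S.ShortExact) {Y : C}
    (h : Subsingleton (Ext S.X₃ Y 1)) (φ : S.X₁ ⟶ Y) : ∃ ψ : S.X₂ ⟶ Y, S.f ≫ ψ = φ := by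
  obtain ⟨x, hx⟩ := Ext.contravariant_sequence_exact₁ hS Y (Ext.mk₀ φ) (add_zero 1)
    (Subsingleton.elim _ _)
  obtain ⟨ψ, rfl⟩ := Ext.homEquiv₀.symm.surjective x
  exact ⟨ψ, Ext.homEquiv₀.symm.injective (by simpa using hx)⟩

theorem exists_lift_of_ext_one {S : ShortComplex C} (hS : S.ShortExact) {X : C}
    (h : Subsingleton (Ext X S.X₁ 1)) (φ : X ⟶ S.X₃) : ∃ ψ : X ⟶ S.X₂, ψ ≫ S.g = φ := by
  obtain ⟨x, hx⟩ := Ext.covariant_sequence_exact₃ X hS (Ext.mk₀ φ) (zero_add 1)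
    (Subsingleton.elim _ _)
  obtain ⟨ψ, rfl⟩ := Ext.homEquiv₀.symm.surjective x
  exact ⟨ψ, Ext.homEquiv₀.symm.injective (by simpa using hx)⟩

theorem ext_one_of_exists_extension {S : ShortComplex C} (hS : S.ShortExact)
    (hP : Projective S.X₂) {Y : C} (h : ∀ φ : S.X₁ ⟶ Y, ∃ ψ : S.X₂ ⟶ Y, S.f ≫ ψ = φ) :
    Subsingleton (Ext S.X₃ Y 1) := by
  refine subsingleton_of_forall_eq 0 fun x => ?_
  have := subsingleton_ext_of_projective S.X₂ Y le_rfl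
  obtain ⟨y, rfl⟩ := Ext.contravariant_sequence_exact₃ hS Y x (Subsingleton.elim _ _)
    (add_zero 1)
  obtain ⟨φ, rfl⟩ := Ext.homEquiv₀.symm.surjective y
  obtain ⟨ψ, rfl⟩ := h φ
  simp [← Ext.mk₀_comp_mk₀]

theorem ext_one_of_exists_lift {S : ShortComplex C} (hS : S.ShortExact)
    (hJ : Injective S.X₂) {X : C} (h : ∀ φ : X ⟶ S.X₃, ∃ ψ : X ⟶ S.X₂, ψ ≫ S.g = φ) :
    Subsingleton (Ext X S.X₁ 1) := by
  refine subsingleton_of_forall_eq 0 fun x => ?_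
  have := subsingleton_ext_of_injective X S.X₂ le_rfl
  obtain ⟨y, rfl⟩ := Ext.covariant_sequence_exact₁ X hS x (Subsingleton.elim _ _) (zero_add 1)
  obtain ⟨φ, rfl⟩ := Ext.homEquiv₀.symm.surjective y
  obtain ⟨ψ, rfl⟩ := h φ
  rw [Ext.homEquiv₀_symm_apply, ← Ext.mk₀_comp_mk₀, Ext.comp_assoc_of_second_deg_zero,
    hS.comp_extClass, Ext.comp_zero]

end Shift

/-- A relation on a type that can be continued forwards and backwards inside a predicate
yields bi-infinite sequences. -/
theorem exists_int_seq {α : Type*} (r : α → α → Prop) (p : α → Prop)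
    (fw : ∀ a, p a → ∃ b, p b ∧ r a b) (bw : ∀ a, p a → ∃ b, p b ∧ r b a) (a : α) (ha : p a) :
    ∃ G : ℤ → α, G 0 = a ∧ (∀ n, p (G n)) ∧ ∀ n, r (G n) (G (n + 1)) := by
  choose! f hf hfr using fw
  choose! b hb hbr using bw
  have pf : ∀ n : ℕ, p (f^[n] a) := fun n => by
    induction n with
    | zero => exact ha
    | succ n ih => rw [Function.iterate_succ_apply']; exact hf _ ih
  have pb : ∀ n : ℕ, p (b^[n] a) := fun n => by
    induction n with
    | zero => exact ha
    | succ n ih => rw [Function.iterate_succ_apply']; exact hb _ ih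
  refine ⟨fun n => match n with
    | Int.ofNat n => f^[n] a
    | Int.negSucc n => b^[n + 1] a, rfl, ?_, ?_⟩
  · rintro (n | n)
    · exact pf n
    · exact pb (n + 1)
  · rintro (n | _ | n)
    · change r (f^[n] a) (f^[n + 1] a)
      rw [Function.iterate_succ_apply']
      exact hfr _ (pf n)
    · exact hbr a ha
    · change r (b^[n + 1 + 1] a) (b^[n + 1] a)
      rw [Function.iterate_succ_apply' b (n + 1)]
      exact hbr _ (pb (n + 1))

section ModuleSES

variable {A : Type u} [Ring A]

/-- `IsSES f g`: the sequence `0 → X → Y → Z → 0` given by `f` and `g` is exact. -/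
def IsSES {X Y Z : ModuleCat.{u} A} (f : X ⟶ Y) (g : Y ⟶ Z) : Prop :=
  ∃ w : f ≫ g = 0, (ShortComplex.mk f g w).ShortExact

theorem _root_.CategoryTheory.ShortComplex.ShortExact.isSES {S : ShortComplex (ModuleCat.{u} A)}
    (hS : S.ShortExact) : IsSES S.f S.g := ⟨S.zero, hS⟩

namespace IsSES

variable {X Y Z : ModuleCat.{u} A} {f : X ⟶ Y} {g : Y ⟶ Z}

theorem injective (h : IsSES f g) : Function.Injective f.hom := h.2.moduleCat_injective_f

theorem surjective (h : IsSES f g) : Function.Surjective g.hom := h.2.moduleCat_surjective_g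

theorem exact (h : IsSES f g) : Function.Exact f.hom g.hom :=
  (ShortComplex.ShortExact.moduleCat_exact_iff_function_exact _).1 h.2.exact

theorem comp_eq_zero (h : IsSES f g) (x : X) : g.hom (f.hom x) = 0 :=
  h.exact.apply_apply_eq_zero x

theorem mono (h : IsSES f g) : Mono f := h.2.mono_f

theorem epi (h : IsSES f g) : Epi g := h.2.epi_g

theorem mk {X Y Z : Type u} [AddCommGroup X] [Module A X] [AddCommGroup Y] [Module A Y]
    [AddCommGroup Z] [Module A Z] {f : X →ₗ[A] Y} {g : Y →ₗ[A] Z} (hf : Function.Injective f)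
    (he : Function.Exact f g) (hg : Function.Surjective g) :
    IsSES (ModuleCat.ofHom f) (ModuleCat.ofHom g) :=
  ⟨by ext x; exact he.apply_apply_eq_zero x, ModuleCat.shortComplex_shortExact _ he hf hg⟩

theorem of_iso {X' Z' : ModuleCat.{u} A} (h : IsSES f g) (e : X ≅ X') (e' : Z ≅ Z') :
    IsSES (e.inv ≫ f) (g ≫ e'.hom) := by
  obtain ⟨w, hS⟩ := h
  refine ⟨by simp [reassoc_of% w], ShortComplex.shortExact_of_iso ?_ hS⟩
  exact ShortComplex.isoMk e (Iso.refl _) e' (by simp) (by simp)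

theorem exists_factor (h : IsSES f g) {T : ModuleCat.{u} A} (φ : Y ⟶ T) (w : f ≫ φ = 0) :
    ∃ ψ : Z ⟶ T, g ≫ ψ = φ := by
  have := h.epi
  exact ⟨h.2.exact.desc φ w, h.2.exact.g_desc φ w⟩

theorem exists_cofactor (h : IsSES f g) {T : ModuleCat.{u} A} (φ : T ⟶ Y) (w : φ ≫ g = 0) :
    ∃ ψ : T ⟶ X, ψ ≫ f = φ := by
  have := h.mono
  exact ⟨h.2.exact.lift φ w, h.2.exact.lift_f φ w⟩

end IsSES

/-- The pushout of two short exact sequences with the same first term. -/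
theorem exists_pushout_ses {K P M Y G : ModuleCat.{u} A} {i : K ⟶ P} {p : P ⟶ M} {a : K ⟶ Y}
    {c : Y ⟶ G} (h : IsSES i p) (h' : IsSES a c) :
    ∃ (W : ModuleCat.{u} A) (f₁ : Y ⟶ W) (g₁ : W ⟶ M) (f₂ : P ⟶ W) (g₂ : W ⟶ G),
      IsSES f₁ g₁ ∧ IsSES f₂ g₂ := by
  let δ : K →ₗ[A] P × Y := i.hom.prod (-a.hom)
  let m := (LinearMap.range δ).mkQ
  have hm : ∀ z, m z = 0 ↔ ∃ k, (i.hom k, -a.hom k) = z := fun z => by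
    rw [Submodule.mkQ_apply, Submodule.Quotient.mk_eq_zero]; rfl
  let g₁ : ((P × Y) ⧸ LinearMap.range δ) →ₗ[A] M :=
    (LinearMap.range δ).liftQ (p.hom ∘ₗ LinearMap.fst A P Y) (by
      rintro _ ⟨k, rfl⟩; exact h.comp_eq_zero k)
  let g₂ : ((P × Y) ⧸ LinearMap.range δ) →ₗ[A] G :=
    (LinearMap.range δ).liftQ (c.hom ∘ₗ LinearMap.snd A P Y) (by
      rintro _ ⟨k, rfl⟩
      simpa [δ] using h'.comp_eq_zero k)
  refine ⟨ModuleCat.of A ((P × Y) ⧸ LinearMap.range δ), ModuleCat.ofHom (m ∘ₗ LinearMap.inr A P Y),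
    ModuleCat.ofHom g₁, ModuleCat.ofHom (m ∘ₗ LinearMap.inl A P Y), ModuleCat.ofHom g₂,
    IsSES.mk ?_ ?_ ?_, IsSES.mk ?_ ?_ ?_⟩
  · rw [injective_iff_map_eq_zero]
    intro y hy
    obtain ⟨k, hk⟩ := (hm _).1 hy
    obtain ⟨hk1, hk2⟩ := Prod.ext_iff.1 hk
    have : k = 0 := h.injective (by rw [map_zero]; exact hk1)
    subst this
    simpa using hk2.symm
  · intro z
    obtain ⟨⟨x, y⟩, rfl⟩ := Submodule.mkQ_surjective _ z
    constructor
    · intro hz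
      obtain ⟨k, hk⟩ := (h.exact x).1 hz
      refine ⟨y + a.hom k, ?_⟩
      rw [← sub_eq_zero]
      change m (0, y + a.hom k) - m (x, y) = 0
      rw [← map_sub, hm]
      exact ⟨-k, by simp [hk]⟩
    · rintro ⟨y', hy'⟩
      rw [← hy']
      change p.hom 0 = 0
      exact map_zero _
  · intro z
    obtain ⟨x, rfl⟩ := h.surjective z
    exact ⟨m (x, 0), rfl⟩
  · rw [injective_iff_map_eq_zero]
    intro x hx
    obtain ⟨k, hk⟩ := (hm _).1 hx
    obtain ⟨hk1, hk2⟩ := Prod.ext_iff.1 hk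
    have : k = 0 := h'.injective (by rw [map_zero]; simpa using hk2)
    subst this
    simpa using hk1.symm
  · intro z
    obtain ⟨⟨x, y⟩, rfl⟩ := Submodule.mkQ_surjective _ z
    constructor
    · intro hz
      obtain ⟨k, hk⟩ := (h'.exact y).1 hz
      refine ⟨x + i.hom k, ?_⟩
      rw [← sub_eq_zero]
      change m (x + i.hom k, 0) - m (x, y) = 0
      rw [← map_sub, hm]
      exact ⟨k, by simp [hk]⟩
    · rintro ⟨x', hx'⟩
      rw [← hx']
      change c.hom 0 = 0
      exact map_zero _
  · intro z
    obtain ⟨y, rfl⟩ := h'.surjective z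
    exact ⟨m (0, y), rfl⟩

/-- The pullback of two short exact sequences with the same last term. -/
theorem exists_pullback_ses {M I C G Y : ModuleCat.{u} A} {i : M ⟶ I} {p : I ⟶ C} {a : G ⟶ Y}
    {c : Y ⟶ C} (h : IsSES i p) (h' : IsSES a c) :
    ∃ (W : ModuleCat.{u} A) (f₁ : G ⟶ W) (g₁ : W ⟶ I) (f₂ : M ⟶ W) (g₂ : W ⟶ Y),
      IsSES f₁ g₁ ∧ IsSES f₂ g₂ := by
  let δ : I × Y →ₗ[A] C := p.hom ∘ₗ LinearMap.fst A I Y - c.hom ∘ₗ LinearMap.snd A I Y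
  have hδ : ∀ z, z ∈ LinearMap.ker δ ↔ p.hom z.1 = c.hom z.2 := fun z => by
    simp [δ, sub_eq_zero]
  let f₁ : G →ₗ[A] LinearMap.ker δ := (LinearMap.inr A I Y ∘ₗ a.hom).codRestrict _ fun x => by
    rw [hδ]; simp [h'.comp_eq_zero x]
  let f₂ : M →ₗ[A] LinearMap.ker δ := (LinearMap.inl A I Y ∘ₗ i.hom).codRestrict _ fun x => by
    rw [hδ]; simp [h.comp_eq_zero x]
  refine ⟨ModuleCat.of A (LinearMap.ker δ), ModuleCat.ofHom f₁,
    ModuleCat.ofHom (LinearMap.fst A I Y ∘ₗ (LinearMap.ker δ).subtype), ModuleCat.ofHom f₂,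
    ModuleCat.ofHom (LinearMap.snd A I Y ∘ₗ (LinearMap.ker δ).subtype),
    IsSES.mk ?_ ?_ ?_, IsSES.mk ?_ ?_ ?_⟩
  · intro x y hxy
    exact h'.injective (congrArg (fun z : LinearMap.ker δ => z.1.2) hxy)
  · rintro ⟨⟨x, y⟩, hxy⟩
    rw [hδ] at hxy
    constructor
    · rintro rfl
      obtain ⟨k, rfl⟩ := (h'.exact y).1 (by rw [← hxy]; exact map_zero _)
      exact ⟨k, rfl⟩
    · rintro ⟨k, hk⟩
      exact (congrArg (fun z : LinearMap.ker δ => z.1.1) hk).symm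
  · intro x
    obtain ⟨y, hy⟩ := h'.surjective (p.hom x)
    exact ⟨⟨(x, y), (hδ _).2 hy.symm⟩, rfl⟩
  · intro x y hxy
    exact h.injective (congrArg (fun z : LinearMap.ker δ => z.1.1) hxy)
  · rintro ⟨⟨x, y⟩, hxy⟩
    rw [hδ] at hxy
    constructor
    · rintro rfl
      obtain ⟨k, rfl⟩ := (h.exact x).1 (hxy.trans (map_zero _))
      exact ⟨k, rfl⟩
    · rintro ⟨k, hk⟩
      exact (congrArg (fun z : LinearMap.ker δ => z.1.2) hk).symm
  · intro y
    obtain ⟨x, hx⟩ := h.surjective (c.hom y)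
    exact ⟨⟨(x, y), (hδ _).2 hx⟩, rfl⟩

/-- The quotient of `Q` by the first term of a short exact sequence `Y → W → M`, where `W ⊆ Q`. -/
theorem exists_quotient_ses {Y W M Q W' : ModuleCat.{u} A} {a : Y ⟶ W} {c : W ⟶ M} {j : W ⟶ Q}
    {q : Q ⟶ W'} (h : IsSES a c) (h' : IsSES j q) :
    ∃ (Z : ModuleCat.{u} A) (g₁ : Q ⟶ Z) (f₂ : M ⟶ Z) (g₂ : Z ⟶ W'),
      IsSES (a ≫ j) g₁ ∧ IsSES f₂ g₂ := by
  let N : Submodule A Q := LinearMap.range (a ≫ j).hom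
  have h₁ : IsSES (a ≫ j) (ModuleCat.ofHom N.mkQ) := IsSES.mk (f := (a ≫ j).hom)
    (h'.injective.comp h.injective) (LinearMap.exact_map_mkQ_range _) N.mkQ_surjective
  obtain ⟨f₂, hf₂⟩ := h.exists_factor (j ≫ ModuleCat.ofHom N.mkQ)
    (by rw [← Category.assoc]; exact h₁.1)
  obtain ⟨g₂, hg₂⟩ := h₁.exists_factor q (by rw [Category.assoc, h'.1, Limits.comp_zero])
  have hf : ∀ w, f₂.hom (c.hom w) = N.mkQ (j.hom w) := fun w => by
    simpa using congrArg (fun φ => φ.hom w) hf₂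
  have hg : ∀ x, g₂.hom (N.mkQ x) = q.hom x := fun x => by
    simpa using congrArg (fun φ => φ.hom x) hg₂
  refine ⟨_, _, f₂, g₂, h₁, IsSES.mk (f := f₂.hom) (g := g₂.hom) ?_ ?_ ?_⟩
  · rw [injective_iff_map_eq_zero]
    intro x hx
    obtain ⟨w, rfl⟩ := h.surjective x
    rw [hf, Submodule.mkQ_apply, Submodule.Quotient.mk_eq_zero] at hx
    obtain ⟨y, hy⟩ := hx
    rw [← h'.injective hy]
    exact h.comp_eq_zero y
  · intro z
    obtain ⟨x, rfl⟩ := N.mkQ_surjective z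
    rw [hg]
    constructor
    · intro hx
      obtain ⟨w, rfl⟩ := (h'.exact x).1 hx
      exact ⟨c.hom w, hf w⟩
    · rintro ⟨y, hy⟩
      obtain ⟨w, rfl⟩ := h.surjective y
      rw [hf] at hy
      rw [← hg, ← hy, hg]
      exact h'.comp_eq_zero w
  · intro z
    obtain ⟨x, rfl⟩ := h'.surjective z
    exact ⟨_, hg x⟩

/-- The kernel of `Q → Y`, where `M → W → Y` is a short exact sequence and `Q → W` is epi. -/
theorem exists_kernel_ses {M W Y Q W' : ModuleCat.{u} A} {a : M ⟶ W} {c : W ⟶ Y} {j : W' ⟶ Q}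
    {q : Q ⟶ W} (h : IsSES a c) (h' : IsSES j q) :
    ∃ (Z : ModuleCat.{u} A) (f₁ : Z ⟶ Q) (f₂ : W' ⟶ Z) (g₂ : Z ⟶ M),
      IsSES f₁ (q ≫ c) ∧ IsSES f₂ g₂ := by
  let N : Submodule A Q := LinearMap.ker (q ≫ c).hom
  have h₁ : IsSES (ModuleCat.ofHom N.subtype) (q ≫ c) := IsSES.mk (g := (q ≫ c).hom)
    N.subtype_injective (LinearMap.exact_subtype_ker_map _) (h.surjective.comp h'.surjective)
  obtain ⟨g₂, hg₂⟩ := h.exists_cofactor (ModuleCat.ofHom N.subtype ≫ q)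
    (by rw [Category.assoc]; exact h₁.1)
  obtain ⟨f₂, hf₂⟩ := h₁.exists_cofactor j (by rw [← Category.assoc, h'.1, Limits.zero_comp])
  have hg : ∀ z : N, a.hom (g₂.hom z) = q.hom z.1 := fun w => by
    simpa using congrArg (fun φ => φ.hom w) hg₂
  have hf : ∀ x, N.subtype (f₂.hom x) = j.hom x := fun x => by
    simpa using congrArg (fun φ => φ.hom x) hf₂
  refine ⟨_, _, f₂, g₂, h₁, IsSES.mk (f := f₂.hom) (g := g₂.hom) ?_ ?_ ?_⟩
  · intro x y hxy
    apply h'.injective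
    rw [← hf, hxy, hf]
  · intro z
    have : g₂.hom z = 0 ↔ q.hom z.1 = 0 := by
      rw [← hg, ← map_zero a.hom, h.injective.eq_iff]
    rw [this]
    constructor
    · intro hx
      obtain ⟨w, hw⟩ := (h'.exact _).1 hx
      exact ⟨w, Subtype.ext ((hf w).trans hw)⟩
    · rintro ⟨y, rfl⟩
      exact (congrArg q.hom (hf y)).trans (h'.comp_eq_zero y)
  · intro x
    obtain ⟨w, hw⟩ := h'.surjective (a.hom x)
    refine ⟨⟨w, ?_⟩, h.injective ?_⟩
    · change c.hom (q.hom w) = 0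
      rw [hw]; exact h.comp_eq_zero x
    · exact (hg _).trans hw

end ModuleSES

section ProjectiveSteps

variable {A : Type u} [Ring A]

/-- `K` is a first syzygy of `M`: there is an exact sequence `0 → K → Q → M → 0` with `Q`
projective. -/
def ProjStep (K M : ModuleCat.{u} A) : Prop :=
  ∃ (Q : ModuleCat.{u} A) (f : K ⟶ Q) (g : Q ⟶ M), IsSES f g ∧ Projective Q

/-- The modules `M` with `Ext^i(M, Q) = 0` for all `i ≥ 1` and all projective modules `Q`. -/
def projPerp (A : Type u) [Ring A] : ObjectProperty (ModuleCat.{u} A) := fun M =>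
  ∀ Q : ModuleCat.{u} A, Projective Q → ∀ i : ℕ, 1 ≤ i → Subsingleton (Abelian.Ext M Q i)

theorem ProjStep.congr {K M K' M' : ModuleCat.{u} A} (h : ProjStep K M) (e : K ≅ K')
    (e' : M ≅ M') : ProjStep K' M' := by
  obtain ⟨Q, f, g, h, hQ⟩ := h
  exact ⟨Q, _, _, h.of_iso e e', hQ⟩

theorem exists_projStep (M : ModuleCat.{u} A) : ∃ K, ProjStep K M :=
  ⟨_, _, _, _, (LinearMap.shortExact_shortComplexKer
    ((ModuleCat.epi_iff_surjective (Projective.π M)).1 inferInstance)).isSES,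
    Projective.projective_over M⟩

theorem ProjStep.ext_iff {K M : ModuleCat.{u} A} (h : ProjStep K M) (Y : ModuleCat.{u} A) {i : ℕ}
    (hi : 1 ≤ i) :
    Subsingleton (Abelian.Ext K Y i) ↔ Subsingleton (Abelian.Ext M Y (i + 1)) := by
  obtain ⟨Q, f, g, h, hQ⟩ := h
  exact subsingleton_ext_shift_left h.2 hQ hi

theorem ProjStep.ext_perp {K M G : ModuleCat.{u} A} (h : ProjStep K M) (hG : projPerp A G) {i : ℕ}
    (hi : 1 ≤ i) (hM : Subsingleton (Abelian.Ext G M i)) :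
    Subsingleton (Abelian.Ext G K (i + 1)) := by
  obtain ⟨Q, f, g, h, hQ⟩ := h
  exact subsingleton_ext_into_X₁ h.2 (hG Q hQ (i + 1) (by omega)) hM

theorem ProjStep.hasProjectiveDimensionLE_iff {K M : ModuleCat.{u} A} (h : ProjStep K M) (n : ℕ) :
    HasProjectiveDimensionLE M (n + 1) ↔ HasProjectiveDimensionLE K n := by
  obtain ⟨Q, f, g, h, hQ⟩ := h
  exact h.2.hasProjectiveDimensionLT_X₃_iff n hQ

theorem ProjStep.projPerp {K M : ModuleCat.{u} A} (h : ProjStep K M) (hM : projPerp A M) :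
    projPerp A K := fun Q hQ i hi =>
  (h.ext_iff Q hi).2 (hM Q hQ (i + 1) (by omega))

theorem isSyzygy_succ_iff {n : ℕ} {M K : ModuleCat.{u} A} :
    IsSyzygy (n + 1) M K ↔ ∃ K', ProjStep K K' ∧ IsSyzygy n M K' := by
  constructor
  · rintro ⟨S, hS, hP, ⟨e⟩, h⟩
    exact ⟨S.X₃, ProjStep.congr ⟨_, _, _, hS.isSES, hP⟩ e (Iso.refl _), h⟩
  · rintro ⟨K', ⟨Q, f, g, h, hQ⟩, h'⟩
    exact ⟨_, h.2, hQ, ⟨Iso.refl _⟩, h'⟩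

theorem exists_isSyzygy (n : ℕ) (M : ModuleCat.{u} A) : ∃ K, IsSyzygy n M K := by
  induction n with
  | zero => exact ⟨M, ⟨Iso.refl _⟩⟩
  | succ n ih =>
    obtain ⟨K, hK⟩ := ih
    obtain ⟨L, hL⟩ := exists_projStep K
    exact ⟨L, isSyzygy_succ_iff.2 ⟨K, hL, hK⟩⟩

theorem IsSyzygy.ext_iff {n : ℕ} {M K : ModuleCat.{u} A} (h : IsSyzygy n M K)
    (Y : ModuleCat.{u} A) {i : ℕ} (hi : 1 ≤ i) :
    Subsingleton (Abelian.Ext K Y i) ↔ Subsingleton (Abelian.Ext M Y (i + n)) := by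
  induction n generalizing K i with
  | zero =>
    obtain ⟨e⟩ := h
    exact ⟨subsingleton_ext_of_retract_left e.retract,
      subsingleton_ext_of_retract_left e.symm.retract⟩
  | succ n ih =>
    obtain ⟨L, hL, h⟩ := isSyzygy_succ_iff.1 h
    rw [hL.ext_iff Y hi, ih h (by omega), add_right_comm, add_assoc]

theorem IsSyzygy.ext_perp {n : ℕ} {M K G : ModuleCat.{u} A} (h : IsSyzygy n M K)
    (hG : projPerp A G) {i : ℕ} (hi : 1 ≤ i) (hM : Subsingleton (Abelian.Ext G M i)) :
    Subsingleton (Abelian.Ext G K (i + n)) := by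
  induction n generalizing K with
  | zero =>
    obtain ⟨e⟩ := h
    exact subsingleton_ext_of_retract_right e.symm.retract hM
  | succ n ih =>
    obtain ⟨L, hL, h⟩ := isSyzygy_succ_iff.1 h
    exact hL.ext_perp hG (i := i + n) (by omega) (ih h)

theorem IsSyzygy.hasProjectiveDimensionLE_iff {n : ℕ} {M K : ModuleCat.{u} A}
    (h : IsSyzygy n M K) (k : ℕ) :
    HasProjectiveDimensionLE M (k + n) ↔ HasProjectiveDimensionLE K k := by
  induction n generalizing K k with
  | zero =>
    obtain ⟨e⟩ := h
    exact ⟨fun _ => hasProjectiveDimensionLT_of_iso e _,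
      fun _ => hasProjectiveDimensionLT_of_iso e.symm _⟩
  | succ n ih =>
    obtain ⟨L, hL, h⟩ := isSyzygy_succ_iff.1 h
    rw [← hL.hasProjectiveDimensionLE_iff, ← ih h, add_right_comm, add_assoc]

theorem IsSyzygy.projective_iff {n : ℕ} {M K : ModuleCat.{u} A} (h : IsSyzygy n M K) :
    HasProjectiveDimensionLE M n ↔ Projective K := by
  rw [projective_iff_hasProjectiveDimensionLE_zero, ← h.hasProjectiveDimensionLE_iff 0, zero_add]

/-- The horseshoe lemma. -/
theorem exists_horseshoe {X Y Z K : ModuleCat.{u} A} {f : X ⟶ Y} {g : Y ⟶ Z} (h : IsSES f g)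
    (hK : ProjStep K X) : ∃ (J L : ModuleCat.{u} A) (a : K ⟶ J) (c : J ⟶ L),
      IsSES a c ∧ ProjStep J Y ∧ ProjStep L Z := by
  obtain ⟨Q, i, p, hip, hQ⟩ := hK
  have hg := h.epi
  let P := Projective.over Z
  let q : P ⟶ Z := Projective.π Z
  have hq : Function.Surjective q.hom := (ModuleCat.epi_iff_surjective q).1 inferInstance
  let s : P ⟶ Y := Projective.factorThru q g
  have hs : ∀ x, g.hom (s.hom x) = q.hom x := fun x =>
    congrArg (fun φ => φ.hom x) (Projective.factorThru_comp q g)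
  let φ : Q × P →ₗ[A] Y := (f.hom ∘ₗ p.hom).coprod s.hom
  have hφ : ∀ x y, φ (x, y) = f.hom (p.hom x) + s.hom y := fun x y => rfl
  have hφs : Function.Surjective φ := fun y => by
    obtain ⟨z, hz⟩ := hq (g.hom y)
    obtain ⟨x, hx⟩ := (h.exact (y - s.hom z)).1 (by rw [map_sub, hs, hz, sub_self])
    obtain ⟨x, rfl⟩ := hip.surjective x
    exact ⟨(x, z), by rw [hφ, hx, sub_add_cancel]⟩
  have hgφ : ∀ z, g.hom (φ z) = q.hom z.2 := fun z => by
    rw [hφ, map_add, h.comp_eq_zero, zero_add, hs]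
  let a : K →ₗ[A] LinearMap.ker φ := (LinearMap.inl A Q P ∘ₗ i.hom).codRestrict _ fun k => by
    rw [LinearMap.mem_ker]
    change φ (i.hom k, 0) = 0
    rw [hφ, hip.comp_eq_zero, map_zero, map_zero, add_zero]
  let c : LinearMap.ker φ →ₗ[A] LinearMap.ker q.hom :=
    (LinearMap.snd A Q P ∘ₗ (LinearMap.ker φ).subtype).codRestrict _ fun z => by
      rw [LinearMap.mem_ker]
      change q.hom z.1.2 = 0
      rw [← hgφ, z.2, map_zero]
  have hQP : Projective (ModuleCat.of A (Q × P)) := by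
    rw [← IsProjective.iff_projective]
    infer_instance
  refine ⟨_, _, ModuleCat.ofHom a, ModuleCat.ofHom c, IsSES.mk ?_ ?_ ?_,
    ⟨_, _, _, (LinearMap.shortExact_shortComplexKer hφs).isSES, hQP⟩,
    ⟨P, _, _, (LinearMap.shortExact_shortComplexKer hq).isSES, Projective.projective_over Z⟩⟩
  · intro x y hxy
    exact hip.injective (congrArg (fun z : LinearMap.ker φ => z.1.1) hxy)
  · rintro ⟨⟨x, y⟩, hxy⟩
    constructor
    · intro h0
      obtain rfl : y = 0 := congrArg Subtype.val h0
      rw [LinearMap.mem_ker, hφ, map_zero, add_zero] at hxy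
      obtain ⟨k, rfl⟩ := (hip.exact x).1 (h.injective (hxy.trans (map_zero _).symm))
      exact ⟨k, rfl⟩
    · rintro ⟨k, hk⟩
      exact Subtype.ext (congrArg (fun z : LinearMap.ker φ => z.1.2) hk).symm
  · rintro ⟨y, hy⟩
    obtain ⟨x, hx⟩ := (h.exact (s.hom y)).1 ((hs y).trans hy)
    obtain ⟨x, rfl⟩ := hip.surjective x
    refine ⟨⟨(-x, y), ?_⟩, rfl⟩
    rw [LinearMap.mem_ker, hφ, map_neg, map_neg, hx, neg_add_cancel]

theorem IsSyzygy.exists_horseshoe {n : ℕ} {M I N K : ModuleCat.{u} A} {f : M ⟶ I} {g : I ⟶ N}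
    (h : IsSES f g) (hK : IsSyzygy n M K) :
    ∃ (J L : ModuleCat.{u} A) (a : K ⟶ J) (c : J ⟶ L),
      IsSES a c ∧ IsSyzygy n I J ∧ IsSyzygy n N L := by
  induction n generalizing K with
  | zero =>
    obtain ⟨e⟩ := hK
    exact ⟨I, N, _, _, h.of_iso e (Iso.refl _), ⟨Iso.refl _⟩, ⟨Iso.refl _⟩⟩
  | succ n ih =>
    obtain ⟨K', hK', h'⟩ := isSyzygy_succ_iff.1 hK
    obtain ⟨J', L', a', c', hac, hJ', hL'⟩ := ih h'
    obtain ⟨J, L, a, c, hac, hJ, hL⟩ := GorensteinArtin.exists_horseshoe hac hK'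
    exact ⟨J, L, a, c, hac, isSyzygy_succ_iff.2 ⟨_, hJ, hJ'⟩, isSyzygy_succ_iff.2 ⟨_, hL, hL'⟩⟩

end ProjectiveSteps

section InjectiveSteps

variable {A : Type u} [Ring A]

/-- `C` is a first cosyzygy of `M`: there is an exact sequence `0 → M → J → C → 0` with `J`
injective. -/
def InjStep (M C : ModuleCat.{u} A) : Prop :=
  ∃ (J : ModuleCat.{u} A) (f : M ⟶ J) (g : J ⟶ C), IsSES f g ∧ Injective J

/-- The modules `M` with `Ext^i(J, M) = 0` for all `i ≥ 1` and all injective modules `J`. -/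
def injPerp (A : Type u) [Ring A] : ObjectProperty (ModuleCat.{u} A) := fun M =>
  ∀ J : ModuleCat.{u} A, Injective J → ∀ i : ℕ, 1 ≤ i → Subsingleton (Abelian.Ext J M i)

theorem InjStep.congr {M C M' C' : ModuleCat.{u} A} (h : InjStep M C) (e : M ≅ M')
    (e' : C ≅ C') : InjStep M' C' := by
  obtain ⟨Q, f, g, h, hQ⟩ := h
  exact ⟨Q, _, _, h.of_iso e e', hQ⟩

theorem isSES_mkQ_range {M N : ModuleCat.{u} A} (f : M ⟶ N) [hf : Mono f] :
    IsSES f (ModuleCat.ofHom (LinearMap.range f.hom).mkQ) :=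
  IsSES.mk (f := f.hom) ((ModuleCat.mono_iff_injective f).1 hf) (LinearMap.exact_map_mkQ_range _)
    (Submodule.mkQ_surjective _)

theorem exists_injStep (M : ModuleCat.{u} A) : ∃ C, InjStep M C :=
  ⟨_, _, _, _, isSES_mkQ_range (Injective.ι M), Injective.injective_under M⟩

theorem InjStep.ext_iff {M C : ModuleCat.{u} A} (h : InjStep M C) (X : ModuleCat.{u} A) {i : ℕ}
    (hi : 1 ≤ i) :
    Subsingleton (Abelian.Ext X C i) ↔ Subsingleton (Abelian.Ext X M (i + 1)) := by
  obtain ⟨Q, f, g, h, hQ⟩ := h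
  exact subsingleton_ext_shift_right h.2 hQ hi

theorem InjStep.ext_perp {M C G : ModuleCat.{u} A} (h : InjStep M C) (hG : injPerp A G) {i : ℕ}
    (hi : 1 ≤ i) (hM : Subsingleton (Abelian.Ext M G i)) :
    Subsingleton (Abelian.Ext C G (i + 1)) := by
  obtain ⟨Q, f, g, h, hQ⟩ := h
  exact subsingleton_ext_X₃ h.2 hM (hG Q hQ (i + 1) (by omega))

theorem InjStep.hasInjectiveDimensionLE_iff {M C : ModuleCat.{u} A} (h : InjStep M C) (n : ℕ) :
    HasInjectiveDimensionLE M (n + 1) ↔ HasInjectiveDimensionLE C n := by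
  obtain ⟨Q, f, g, h, hQ⟩ := h
  exact (h.2.hasInjectiveDimensionLT_X₃_iff n hQ).symm

theorem InjStep.injPerp {M C : ModuleCat.{u} A} (h : InjStep M C) (hM : injPerp A M) :
    injPerp A C := fun Q hQ i hi =>
  (h.ext_iff Q hi).2 (hM Q hQ (i + 1) (by omega))

theorem isCosyzygy_succ_iff {n : ℕ} {M K : ModuleCat.{u} A} :
    IsCosyzygy (n + 1) M K ↔ ∃ K', InjStep K' K ∧ IsCosyzygy n M K' := by
  constructor
  · rintro ⟨S, hS, hP, ⟨e⟩, h⟩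
    exact ⟨S.X₁, InjStep.congr ⟨_, _, _, hS.isSES, hP⟩ (Iso.refl _) e, h⟩
  · rintro ⟨K', ⟨Q, f, g, h, hQ⟩, h'⟩
    exact ⟨_, h.2, hQ, ⟨Iso.refl _⟩, h'⟩

theorem exists_isCosyzygy (n : ℕ) (M : ModuleCat.{u} A) : ∃ K, IsCosyzygy n M K := by
  induction n with
  | zero => exact ⟨M, ⟨Iso.refl _⟩⟩
  | succ n ih =>
    obtain ⟨K, hK⟩ := ih
    obtain ⟨L, hL⟩ := exists_injStep K
    exact ⟨L, isCosyzygy_succ_iff.2 ⟨K, hL, hK⟩⟩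

theorem IsCosyzygy.ext_iff {n : ℕ} {M K : ModuleCat.{u} A} (h : IsCosyzygy n M K)
    (X : ModuleCat.{u} A) {i : ℕ} (hi : 1 ≤ i) :
    Subsingleton (Abelian.Ext X K i) ↔ Subsingleton (Abelian.Ext X M (i + n)) := by
  induction n generalizing K i with
  | zero =>
    obtain ⟨e⟩ := h
    exact ⟨subsingleton_ext_of_retract_right e.retract,
      subsingleton_ext_of_retract_right e.symm.retract⟩
  | succ n ih =>
    obtain ⟨L, hL, h⟩ := isCosyzygy_succ_iff.1 h
    rw [hL.ext_iff X hi, ih h (by omega), add_right_comm, add_assoc]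

theorem IsCosyzygy.ext_perp {n : ℕ} {M K G : ModuleCat.{u} A} (h : IsCosyzygy n M K)
    (hG : injPerp A G) {i : ℕ} (hi : 1 ≤ i) (hM : Subsingleton (Abelian.Ext M G i)) :
    Subsingleton (Abelian.Ext K G (i + n)) := by
  induction n generalizing K with
  | zero =>
    obtain ⟨e⟩ := h
    exact subsingleton_ext_of_retract_left e.symm.retract hM
  | succ n ih =>
    obtain ⟨L, hL, h⟩ := isCosyzygy_succ_iff.1 h
    exact hL.ext_perp hG (i := i + n) (by omega) (ih h)

theorem IsCosyzygy.hasInjectiveDimensionLE_iff {n : ℕ} {M K : ModuleCat.{u} A}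
    (h : IsCosyzygy n M K) (k : ℕ) :
    HasInjectiveDimensionLE M (k + n) ↔ HasInjectiveDimensionLE K k := by
  induction n generalizing K k with
  | zero =>
    obtain ⟨e⟩ := h
    exact ⟨fun _ => hasInjectiveDimensionLT_of_iso e _,
      fun _ => hasInjectiveDimensionLT_of_iso e.symm _⟩
  | succ n ih =>
    obtain ⟨L, hL, h⟩ := isCosyzygy_succ_iff.1 h
    rw [← hL.hasInjectiveDimensionLE_iff, ← ih h, add_right_comm, add_assoc]

theorem IsCosyzygy.injective_iff {n : ℕ} {M K : ModuleCat.{u} A} (h : IsCosyzygy n M K) :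
    HasInjectiveDimensionLE M n ↔ Injective K := by
  have := h.hasInjectiveDimensionLE_iff 0
  rw [zero_add] at this
  exact this.trans injective_iff_hasInjectiveDimensionLT_one.symm

/-- The dual of the horseshoe lemma. -/
theorem exists_cohorseshoe {X Y Z K : ModuleCat.{u} A} {f : X ⟶ Y} {g : Y ⟶ Z} (h : IsSES f g)
    (hK : InjStep Z K) : ∃ (L J : ModuleCat.{u} A) (a : L ⟶ J) (c : J ⟶ K),
      IsSES a c ∧ InjStep Y J ∧ InjStep X L := by
  obtain ⟨Q, i, p, hip, hQ⟩ := hK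
  have hf := h.mono
  let P := Injective.under X
  let q : X ⟶ P := Injective.ι X
  have hq : Function.Injective q.hom := (ModuleCat.mono_iff_injective q).1 inferInstance
  let s : Y ⟶ P := Injective.factorThru q f
  have hs : ∀ x, s.hom (f.hom x) = q.hom x := fun x =>
    congrArg (fun φ => φ.hom x) (Injective.comp_factorThru q f)
  let φ : Y →ₗ[A] P × Q := s.hom.prod (i.hom ∘ₗ g.hom)
  have hφ : ∀ y, φ y = (s.hom y, i.hom (g.hom y)) := fun y => rfl
  have hφi : Function.Injective φ := by
    rw [injective_iff_map_eq_zero]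
    intro y hy
    obtain ⟨h1, h2⟩ := Prod.ext_iff.1 hy
    obtain ⟨x, rfl⟩ := (h.exact y).1 (hip.injective (h2.trans (map_zero _).symm))
    have h3 : q.hom x = 0 := (hs x).symm.trans h1
    rw [hq (h3.trans (map_zero _).symm), map_zero]
  let a : (P ⧸ LinearMap.range q.hom) →ₗ[A] ((P × Q) ⧸ LinearMap.range φ) :=
    Submodule.mapQ _ _ (LinearMap.inl A P Q) (by
      rintro _ ⟨x, rfl⟩
      refine ⟨f.hom x, ?_⟩
      rw [hφ, hs, h.comp_eq_zero, map_zero]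
      rfl)
  let c : ((P × Q) ⧸ LinearMap.range φ) →ₗ[A] K :=
    (LinearMap.range φ).liftQ (p.hom ∘ₗ LinearMap.snd A P Q) (by
      rintro _ ⟨x, rfl⟩; exact hip.comp_eq_zero _)
  have hPQ : Injective (ModuleCat.of A (P × Q)) := by
    have : Injective (P ⊞ Q) := inferInstance
    exact Injective.of_iso (ModuleCat.biprodIsoProd P Q) this
  have : Mono (ModuleCat.ofHom φ) := (ModuleCat.mono_iff_injective _).2 hφi
  refine ⟨_, _, ModuleCat.ofHom a, ModuleCat.ofHom c, IsSES.mk ?_ ?_ ?_,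
    ⟨_, _, _, isSES_mkQ_range (ModuleCat.ofHom φ), hPQ⟩,
    ⟨P, _, _, isSES_mkQ_range q, Injective.injective_under X⟩⟩
  · rw [injective_iff_map_eq_zero]
    intro z hz
    obtain ⟨x, rfl⟩ := Submodule.mkQ_surjective _ z
    obtain ⟨y, hy⟩ := (Submodule.Quotient.mk_eq_zero _).1 hz
    obtain ⟨h1, h2⟩ := Prod.ext_iff.1 hy
    obtain ⟨w, rfl⟩ := (h.exact y).1 (hip.injective (h2.trans (map_zero _).symm))
    exact (Submodule.Quotient.mk_eq_zero _).2 ⟨w, (hs w).symm.trans h1⟩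
  · intro z
    obtain ⟨⟨x, y⟩, rfl⟩ := Submodule.mkQ_surjective _ z
    constructor
    · intro h0
      obtain ⟨w, rfl⟩ := (hip.exact y).1 h0
      obtain ⟨w, rfl⟩ := h.surjective w
      refine ⟨Submodule.mkQ _ (x - s.hom w), (Submodule.Quotient.eq _).2 ⟨-w, ?_⟩⟩
      rw [map_neg, hφ]
      simp
    · rintro ⟨w, hw⟩
      obtain ⟨w, rfl⟩ := Submodule.mkQ_surjective _ w
      rw [← hw]
      exact map_zero p.hom
  · intro z
    obtain ⟨y, rfl⟩ := hip.surjective z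
    exact ⟨Submodule.mkQ _ (0, y), rfl⟩

theorem IsCosyzygy.exists_cohorseshoe {n : ℕ} {N I M K : ModuleCat.{u} A} {f : N ⟶ I}
    {g : I ⟶ M} (h : IsSES f g) (hK : IsCosyzygy n M K) :
    ∃ (L J : ModuleCat.{u} A) (a : L ⟶ J) (c : J ⟶ K),
      IsSES a c ∧ IsCosyzygy n I J ∧ IsCosyzygy n N L := by
  induction n generalizing K with
  | zero =>
    obtain ⟨e⟩ := hK
    exact ⟨N, I, _, _, h.of_iso (Iso.refl _) e, ⟨Iso.refl _⟩, ⟨Iso.refl _⟩⟩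
  | succ n ih =>
    obtain ⟨K', hK', h'⟩ := isCosyzygy_succ_iff.1 hK
    obtain ⟨J', L', a', c', hac, hJ', hL'⟩ := ih h'
    obtain ⟨J, L, a, c, hac, hJ, hL⟩ := GorensteinArtin.exists_cohorseshoe hac hK'
    exact ⟨J, L, a, c, hac, isCosyzygy_succ_iff.2 ⟨_, hJ, hJ'⟩,
      isCosyzygy_succ_iff.2 ⟨_, hL, hL'⟩⟩

end InjectiveSteps

section Complexes

variable {A : Type u} [Ring A]

theorem acyclic_iff_function_exact (P : CochainComplex (ModuleCat.{u} A) ℤ) :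
    P.Acyclic ↔
      ∀ n : ℤ, Function.Exact (P.d n (n + 1)).hom (P.d (n + 1) (n + 1 + 1)).hom := by
  have key : ∀ n : ℤ, P.ExactAt (n + 1) ↔
      Function.Exact (P.d n (n + 1)).hom (P.d (n + 1) (n + 1 + 1)).hom := fun n => by
    rw [P.exactAt_iff' n (n + 1) (n + 1 + 1) (by simp) (by simp)]
    exact ShortComplex.ShortExact.moduleCat_exact_iff_function_exact _
  refine ⟨fun h n => (key n).1 (h _), fun h n => ?_⟩
  obtain ⟨m, rfl⟩ : ∃ m, n = m + 1 := ⟨n - 1, by ring⟩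
  exact (key m).2 (h m)

/-- The corestriction of the differential of a complex to cocycles. -/
def toCocycles (P : CochainComplex (ModuleCat.{u} A) ℤ) (n : ℤ) :
    P.X n →ₗ[A] LinearMap.ker (P.d (n + 1) (n + 1 + 1)).hom :=
  (P.d n (n + 1)).hom.codRestrict _ fun x => by
    rw [LinearMap.mem_ker, ← LinearMap.comp_apply, ← ModuleCat.hom_comp, P.d_comp_d]
    rfl

theorem ker_eq_range_of_acyclic {P : CochainComplex (ModuleCat.{u} A) ℤ} (hP : P.Acyclic)
    {m n : ℤ} (h : m + 1 = n) :
    LinearMap.ker (P.d n (n + 1)).hom = LinearMap.range (P.d m n).hom := by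
  subst h
  exact ((acyclic_iff_function_exact P).1 hP m).linearMap_ker_eq

theorem isSES_cocycles {P : CochainComplex (ModuleCat.{u} A) ℤ} (hP : P.Acyclic) (n : ℤ) :
    IsSES (ModuleCat.ofHom (LinearMap.ker (P.d n (n + 1)).hom).subtype)
      (ModuleCat.ofHom (toCocycles P n)) := by
  refine IsSES.mk (Submodule.subtype_injective _) (fun x => ?_) (fun x => ?_)
  · rw [Subtype.ext_iff]
    exact ⟨fun h => ⟨⟨x, h⟩, rfl⟩, by rintro ⟨y, rfl⟩; exact y.2⟩
  · obtain ⟨y, hy⟩ := ((acyclic_iff_function_exact P).1 hP n x.1).1 x.2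
    exact ⟨y, Subtype.ext hy⟩

/-- The complex obtained by splicing short exact sequences `0 → G n → X n → G (n + 1) → 0`. -/
abbrev spliceComplex {G X : ℤ → ModuleCat.{u} A} (f : ∀ n, G n ⟶ X n) (g : ∀ n, X n ⟶ G (n + 1))
    (h : ∀ n, IsSES (f n) (g n)) : CochainComplex (ModuleCat.{u} A) ℤ :=
  CochainComplex.of X (fun n => g n ≫ f (n + 1)) fun n => by
    rw [Category.assoc, ← Category.assoc (f (n + 1)), (h (n + 1)).1, Limits.zero_comp,
      Limits.comp_zero]

section Splice

variable {G X : ℤ → ModuleCat.{u} A} {f : ∀ n, G n ⟶ X n} {g : ∀ n, X n ⟶ G (n + 1)}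
  (h : ∀ n, IsSES (f n) (g n))

theorem spliceComplex_d (n : ℤ) : (spliceComplex f g h).d n (n + 1) = g n ≫ f (n + 1) :=
  CochainComplex.of_d X (fun n => g n ≫ f (n + 1)) n

theorem ker_spliceComplex_d (n : ℤ) :
    LinearMap.ker ((spliceComplex f g h).d n (n + 1)).hom = LinearMap.range (f n).hom := by
  rw [spliceComplex_d]
  ext x
  have : (f (n + 1)).hom ((g n).hom x) = 0 ↔ (g n).hom x = 0 := by
    rw [← map_zero (f (n + 1)).hom, (h (n + 1)).injective.eq_iff]
  exact this.trans ((h n).exact x)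

theorem range_spliceComplex_d {m n : ℤ} (hmn : m + 1 = n) :
    LinearMap.range ((spliceComplex f g h).d m n).hom = LinearMap.range (f n).hom := by
  subst hmn
  rw [spliceComplex_d]
  exact LinearMap.range_comp_of_range_eq_top _ (LinearMap.range_eq_top.2 (h m).surjective)

theorem acyclic_spliceComplex : (spliceComplex f g h).Acyclic := by
  rw [acyclic_iff_function_exact]
  intro n
  rw [LinearMap.exact_iff, ker_spliceComplex_d, range_spliceComplex_d h rfl]

end Splice

/-- The cocycles of a totally acyclic complex are orthogonal to projective modules. -/
theorem IsTotallyAcyclic.projPerp_ker {P : CochainComplex (ModuleCat.{u} A) ℤ}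
    (hP : IsTotallyAcyclic P) (n : ℤ) :
    projPerp A (ModuleCat.of A (LinearMap.ker (P.d n (n + 1)).hom)) := by
  intro Q hQ i hi
  induction i, hi using Nat.le_induction generalizing n with
  | base =>
    obtain ⟨k, rfl⟩ : ∃ k, n = k + 1 + 1 := ⟨n - 2, by ring⟩
    refine ext_one_of_exists_extension (isSES_cocycles hP.acyclic (k + 1)).2
      (hP.projective (k + 1)) fun φ => ?_
    have he := (isSES_cocycles hP.acyclic k).epi
    obtain ⟨ψ, hψ⟩ := hP.hom_acyclic Q hQ k (ModuleCat.ofHom (toCocycles P k) ≫ φ) (by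
      rw [← Category.assoc]
      have : P.d (k - 1) k ≫ ModuleCat.ofHom (toCocycles P k) = 0 := by
        ext x
        exact congrArg (fun φ => φ.hom x) (P.d_comp_d (k - 1) k (k + 1))
      rw [this, Limits.zero_comp])
    refine ⟨ψ, ?_⟩
    rw [← cancel_epi (ModuleCat.ofHom (toCocycles P k)), ← hψ, ← Category.assoc]
    rfl
  | succ i hi ih =>
    obtain ⟨k, rfl⟩ : ∃ k, n = k + 1 := ⟨n - 1, by ring⟩
    exact (subsingleton_ext_shift_left (isSES_cocycles hP.acyclic k).2
      (hP.projective k) hi).1 (ih k)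

/-- The cocycles of a cototally acyclic complex are orthogonal to injective modules. -/
theorem IsCototallyAcyclic.injPerp_ker {I : CochainComplex (ModuleCat.{u} A) ℤ}
    (hI : IsCototallyAcyclic I) (n : ℤ) :
    injPerp A (ModuleCat.of A (LinearMap.ker (I.d n (n + 1)).hom)) := by
  intro J hJ i hi
  induction i, hi using Nat.le_induction generalizing n with
  | base =>
    refine ext_one_of_exists_lift (isSES_cocycles hI.acyclic n).2 (hI.injective n) fun φ => ?_
    have hlift := hI.hom_acyclic J hJ (n + 1)
      (φ ≫ ModuleCat.ofHom (LinearMap.ker (I.d (n + 1) (n + 1 + 1)).hom).subtype) (by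
        ext x; exact (φ.hom x).2)
    rw [add_sub_cancel_right] at hlift
    obtain ⟨ψ, hψ⟩ := hlift
    refine ⟨ψ, ?_⟩
    have hm := (isSES_cocycles hI.acyclic (n + 1)).mono
    rw [← cancel_mono
      (ModuleCat.ofHom (LinearMap.ker (I.d (n + 1) (n + 1 + 1)).hom).subtype), ← hψ]
    rfl
  | succ i hi ih =>
    exact (subsingleton_ext_shift_right (isSES_cocycles hI.acyclic n).2
      (hI.injective n) hi).1 (ih (n + 1))

/-- Coinduction principle for Gorenstein-projective modules. -/
theorem gproj_of_coinductive (p : ModuleCat.{u} A → Prop)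
    (hp : ∀ X, p X → projPerp A X ∧ ∃ Y, p Y ∧ ProjStep X Y) {M : ModuleCat.{u} A} (hM : p M) :
    GProj A M := by
  let p' : ModuleCat.{u} A → Prop := fun X => ∃ q : ModuleCat.{u} A → Prop, q X ∧
    ∀ X, q X → projPerp A X ∧ ∃ Y, q Y ∧ ProjStep X Y
  obtain ⟨G, rfl, hGp, hG⟩ := exists_int_seq ProjStep p'
    (by
      rintro X ⟨q, hqX, hq⟩
      obtain ⟨-, Y, hY, h⟩ := hq X hqX
      exact ⟨Y, ⟨q, hY, hq⟩, h⟩)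
    (by
      rintro X ⟨q, hqX, hq⟩
      obtain ⟨K, hK⟩ := exists_projStep X
      refine ⟨K, ⟨fun Z => q Z ∨ Z = K, Or.inr rfl, ?_⟩, hK⟩
      rintro Z (hZ | rfl)
      · obtain ⟨h, Y, hY, h'⟩ := hq Z hZ
        exact ⟨h, Y, Or.inl hY, h'⟩
      · exact ⟨hK.projPerp (hq X hqX).1, X, Or.inl hqX, hK⟩) M ⟨p, hM, hp⟩
  have hperp : ∀ n, projPerp A (G n) := fun n => by
    obtain ⟨q, hqX, hq⟩ := hGp n
    exact (hq _ hqX).1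
  choose X f g h hX using hG
  refine ⟨spliceComplex f g h, ⟨hX, acyclic_spliceComplex h, fun Q hQ n φ hφ => ?_⟩, ⟨?_⟩⟩
  · obtain ⟨m, rfl⟩ : ∃ m, n = m + 1 := ⟨n - 1, by ring⟩
    rw [add_sub_cancel_right, spliceComplex_d, Category.assoc] at hφ
    have he := (h m).epi
    obtain ⟨ψ, rfl⟩ := (h (m + 1)).exists_factor φ (by
      rwa [← cancel_epi (g m), Limits.comp_zero])
    obtain ⟨χ, rfl⟩ := exists_extension_of_ext_one (h (m + 1 + 1)).2
      (hperp (m + 1 + 1 + 1) Q hQ 1 le_rfl) ψ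
    refine ⟨χ, ?_⟩
    rw [spliceComplex_d, Category.assoc]
  · exact (LinearEquiv.ofInjective _ (h 0).injective).trans
      (LinearEquiv.ofEq _ _ (ker_spliceComplex_d h 0).symm)

/-- Coinduction principle for Gorenstein-injective modules. -/
theorem ginj_of_coinductive (p : ModuleCat.{u} A → Prop)
    (hp : ∀ X, p X → injPerp A X ∧ ∃ Y, p Y ∧ InjStep Y X) {M : ModuleCat.{u} A} (hM : p M) :
    GInj A M := by
  let p' : ModuleCat.{u} A → Prop := fun X => ∃ q : ModuleCat.{u} A → Prop, q X ∧
    ∀ X, q X → injPerp A X ∧ ∃ Y, q Y ∧ InjStep Y X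
  obtain ⟨G, rfl, hGp, hG⟩ := exists_int_seq InjStep p'
    (by
      rintro X ⟨q, hqX, hq⟩
      obtain ⟨K, hK⟩ := exists_injStep X
      refine ⟨K, ⟨fun Z => q Z ∨ Z = K, Or.inr rfl, ?_⟩, hK⟩
      rintro Z (hZ | rfl)
      · obtain ⟨h, Y, hY, h'⟩ := hq Z hZ
        exact ⟨h, Y, Or.inl hY, h'⟩
      · exact ⟨hK.injPerp (hq X hqX).1, X, Or.inl hqX, hK⟩)
    (by
      rintro X ⟨q, hqX, hq⟩
      obtain ⟨-, Y, hY, h⟩ := hq X hqX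
      exact ⟨Y, ⟨q, hY, hq⟩, h⟩) M ⟨p, hM, hp⟩
  have hperp : ∀ n, injPerp A (G n) := fun n => by
    obtain ⟨q, hqX, hq⟩ := hGp n
    exact (hq _ hqX).1
  choose X f g h hX using hG
  refine ⟨spliceComplex f g h, ⟨hX, acyclic_spliceComplex h, fun J hJ n φ hφ => ?_⟩, ⟨?_⟩⟩
  · obtain ⟨m, rfl⟩ : ∃ m, n = m + 1 := ⟨n - 1, by ring⟩
    rw [spliceComplex_d, ← Category.assoc] at hφ
    have he := (h (m + 1 + 1)).mono
    obtain ⟨ψ, rfl⟩ := (h (m + 1)).exists_cofactor φ (by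
      rwa [← cancel_mono (f (m + 1 + 1)), Limits.zero_comp])
    obtain ⟨χ, rfl⟩ := exists_lift_of_ext_one (h m).2 (hperp m J hJ 1 le_rfl) ψ
    rw [add_sub_cancel_right]
    refine ⟨χ, ?_⟩
    rw [spliceComplex_d, Category.assoc]
  · exact (LinearEquiv.ofInjective _ (h 0).injective).trans
      (LinearEquiv.ofEq _ _ (range_spliceComplex_d h (by norm_num)).symm)

theorem GProj.exists_projStep {M : ModuleCat.{u} A} (hM : GProj A M) :
    projPerp A M ∧ ∃ Y, GProj A Y ∧ ProjStep M Y := by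
  obtain ⟨P, hP, ⟨e⟩⟩ := hM
  let p : ModuleCat.{u} A → Prop := fun X => ∃ n : ℤ,
    Nonempty (ModuleCat.of A (LinearMap.ker (P.d n (n + 1)).hom) ≅ X)
  have hp : ∀ X, p X → projPerp A X ∧ ∃ Y, p Y ∧ ProjStep X Y := by
    rintro X ⟨n, ⟨e⟩⟩
    refine ⟨fun Q hQ i hi => subsingleton_ext_of_retract_left e.symm.retract
      (hP.projPerp_ker n Q hQ i hi), _, ⟨n + 1, ⟨Iso.refl _⟩⟩,
      ProjStep.congr ⟨_, _, _, isSES_cocycles hP.acyclic n, hP.projective n⟩ e (Iso.refl _)⟩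
  obtain ⟨h, Y, hY, h'⟩ := hp M ⟨0, ⟨e.toModuleIso.symm⟩⟩
  exact ⟨h, Y, gproj_of_coinductive p hp hY, h'⟩

theorem GInj.exists_injStep {M : ModuleCat.{u} A} (hM : GInj A M) :
    injPerp A M ∧ ∃ Y, GInj A Y ∧ InjStep Y M := by
  obtain ⟨I, hI, ⟨e⟩⟩ := hM
  let p : ModuleCat.{u} A → Prop := fun X => ∃ n : ℤ,
    Nonempty (ModuleCat.of A (LinearMap.ker (I.d n (n + 1)).hom) ≅ X)
  have hp : ∀ X, p X → injPerp A X ∧ ∃ Y, p Y ∧ InjStep Y X := by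
    rintro X ⟨n, ⟨e⟩⟩
    obtain ⟨k, rfl⟩ : ∃ k, n = k + 1 := ⟨n - 1, by ring⟩
    refine ⟨fun Q hQ i hi => subsingleton_ext_of_retract_right e.symm.retract
      (hI.injPerp_ker (k + 1) Q hQ i hi), _, ⟨k, ⟨Iso.refl _⟩⟩,
      InjStep.congr ⟨_, _, _, isSES_cocycles hI.acyclic k, hI.injective k⟩ (Iso.refl _) e⟩
  have hk : LinearMap.ker (I.d 0 (0 + 1)).hom = LinearMap.range (I.d (-1) 0).hom :=
    ker_eq_range_of_acyclic hI.acyclic (by norm_num)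
  obtain ⟨h, Y, hY, h'⟩ := hp M
    ⟨0, ⟨((LinearEquiv.ofEq _ _ hk).trans e.symm).toModuleIso⟩⟩
  exact ⟨h, Y, ginj_of_coinductive p hp hY, h'⟩

end Complexes

/-- A class of objects containing the zero objects and closed under retracts and extensions is
closed under finite products. -/
theorem isClosedUnderFiniteProducts_of_extensions {C : Type u} [Category.{v} C] [Abelian C]
    (P : ObjectProperty C) (h₀ : ∀ Z : C, Limits.IsZero Z → P Z) (hr : P.IsStableUnderRetracts)
    (he : ∀ S : ShortComplex C, S.ShortExact → P S.X₁ → P S.X₃ → P S.X₂) :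
    P.IsClosedUnderFiniteProducts := by
  have : P.ContainsZero := ⟨_, Limits.isZero_zero C, h₀ _ (Limits.isZero_zero C)⟩
  have : P.IsClosedUnderIsomorphisms := ⟨fun e h => hr.of_retract e.symm.retract h⟩
  have : P.IsClosedUnderBinaryProducts := ⟨by
    rintro X ⟨p⟩
    refine P.prop_of_iso ?_ (he _ (ShortComplex.Splitting.ofHasBinaryBiproduct _ _).shortExact
      (p.prop_diag_obj (.mk .left)) (p.prop_diag_obj (.mk .right)))
    exact Limits.IsLimit.conePointUniqueUpToIso (Limits.BinaryBiproduct.isLimit _ _)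
      ((Limits.IsLimit.postcomposeHomEquiv (Limits.diagramIsoPair p.diag) _).2 p.isLimit)⟩
  exact .mk'

section Projective

variable {A : Type u} [Ring A]

theorem projPerp_isStableUnderRetracts : (projPerp A).IsStableUnderRetracts :=
  ⟨fun r h Q hQ i hi => subsingleton_ext_of_retract_left r (h Q hQ i hi)⟩

theorem projPerp_of_projective (P : ModuleCat.{u} A) [Projective P] : projPerp A P :=
  fun Q _ _ hi => subsingleton_ext_of_projective P Q hi

theorem projPerp_of_extension {S : ShortComplex (ModuleCat.{u} A)} (hS : S.ShortExact)
    (h₁ : projPerp A S.X₁) (h₃ : projPerp A S.X₃) : projPerp A S.X₂ := fun Q hQ i hi =>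
  subsingleton_ext_X₂ hS (h₁ Q hQ i hi) (h₃ Q hQ i hi)

theorem projPerp_isClosedUnderFiniteProducts : (projPerp A).IsClosedUnderFiniteProducts :=
  isClosedUnderFiniteProducts_of_extensions _
    (fun Z hZ => have := hZ.projective; projPerp_of_projective Z)
    projPerp_isStableUnderRetracts (fun _ hS => projPerp_of_extension hS)

theorem projDimLE_isStableUnderRetracts (d : ℕ) : (projDimLE A d).IsStableUnderRetracts :=
  ⟨fun r h => have : HasProjectiveDimensionLE _ d := h; r.hasProjectiveDimensionLT _⟩

theorem projDimLE_isClosedUnderFiniteProducts (d : ℕ) :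
    (projDimLE A d).IsClosedUnderFiniteProducts :=
  isClosedUnderFiniteProducts_of_extensions _
    (fun Z hZ => have := hZ.hasProjectiveDimensionLT_zero; hasProjectiveDimensionLT_of_ge Z 0 _
      (Nat.zero_le _))
    (projDimLE_isStableUnderRetracts d) (fun _ hS => hS.hasProjectiveDimensionLT_X₂ _)

/-- Modules orthogonal to projective modules are orthogonal to modules of finite projective
dimension. -/
theorem projPerp.ext_projDimLE {X Y : ModuleCat.{u} A} (hX : projPerp A X) {n : ℕ}
    (hY : HasProjectiveDimensionLE Y n) {i : ℕ} (hi : 1 ≤ i) :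
    Subsingleton (Abelian.Ext X Y i) := by
  induction n generalizing Y i with
  | zero => exact hX Y ((projective_iff_hasProjectiveDimensionLE_zero Y).2 hY) i hi
  | succ n ih =>
    obtain ⟨K, hK⟩ := exists_projStep Y
    have hKn := (hK.hasProjectiveDimensionLE_iff n).1 hY
    obtain ⟨Q, f, g, h, hQ⟩ := hK
    exact subsingleton_ext_into_X₃ h.2 (ih hKn (by omega)) (hX Q hQ i hi)

theorem projPerp.projective {X : ModuleCat.{u} A} (hX : projPerp A X) {n : ℕ}
    (hn : HasProjectiveDimensionLE X n) : Projective X := by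
  obtain ⟨K, hK⟩ := exists_projStep X
  have hKn : HasProjectiveDimensionLE K n :=
    (hK.hasProjectiveDimensionLE_iff n).1 (hasProjectiveDimensionLT_of_ge X (n + 1) _ (by omega))
  obtain ⟨Q, f, g, h, hQ⟩ := hK
  obtain ⟨s, hs⟩ := exists_lift_of_ext_one h.2 (hX.ext_projDimLE hKn le_rfl) (𝟙 X)
  exact Retract.projective (Y := Q) ⟨s, g, hs⟩

theorem GProj.projPerp {M : ModuleCat.{u} A} (hM : GProj A M) : projPerp A M :=
  hM.exists_projStep.1

theorem GProj.exists_isSyzygy {M : ModuleCat.{u} A} (hM : GProj A M) (n : ℕ) :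
    ∃ G, GProj A G ∧ IsSyzygy n G M := by
  induction n generalizing M with
  | zero => exact ⟨M, hM, ⟨Iso.refl _⟩⟩
  | succ n ih =>
    obtain ⟨-, Y, hY, h⟩ := hM.exists_projStep
    obtain ⟨G, hG, h'⟩ := ih hY
    exact ⟨G, hG, isSyzygy_succ_iff.2 ⟨Y, h, h'⟩⟩

/-- A module that is orthogonal to projectives and has a Gorenstein-projective cosyzygy is
Gorenstein-projective. -/
theorem gproj_of_projStep {M Y : ModuleCat.{u} A} (hM : projPerp A M) (h : ProjStep M Y)
    (hY : GProj A Y) : GProj A M := by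
  refine gproj_of_coinductive (fun X => GProj A X ∨ X = M) ?_ (Or.inr rfl)
  rintro X (hX | rfl)
  · obtain ⟨h, Z, hZ, h'⟩ := hX.exists_projStep
    exact ⟨h, Z, Or.inl hZ, h'⟩
  · exact ⟨hM, Y, Or.inl hY, h⟩

theorem gproj_of_extension_by_projective {P W G : ModuleCat.{u} A} {f : P ⟶ W} {g : W ⟶ G}
    (h : IsSES f g) (hP : Projective P) (hG : GProj A G) : GProj A W := by
  obtain ⟨hG', Y, hY, Q, j, c, hjc, hQ⟩ := hG.exists_projStep
  have hW : projPerp A W := projPerp_of_extension h.2 (projPerp_of_projective P) hG'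
  obtain ⟨r, hr⟩ := exists_extension_of_ext_one h.2 (hG' P hP 1 le_rfl) (𝟙 P)
  have hr' : ∀ x, r.hom (f.hom x) = x := fun x => congrArg (fun φ => φ.hom x) hr
  have hPQ : Projective (ModuleCat.of A (P × Q)) := by
    rw [← IsProjective.iff_projective]
    infer_instance
  refine gproj_of_projStep hW ⟨ModuleCat.of A (P × Q),
    ModuleCat.ofHom (r.hom.prod (j.hom ∘ₗ g.hom)),
    ModuleCat.ofHom (c.hom ∘ₗ LinearMap.snd A P Q), IsSES.mk ?_ ?_ ?_, hPQ⟩ hY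
  · rw [injective_iff_map_eq_zero]
    intro w hw
    obtain ⟨h1, h2⟩ := Prod.ext_iff.1 hw
    obtain ⟨x, rfl⟩ := (h.exact w).1 (hjc.injective (h2.trans (map_zero _).symm))
    rw [← hr' x]
    exact (congrArg f.hom h1).trans (map_zero _)
  · rintro ⟨x, y⟩
    constructor
    · intro h0
      obtain ⟨z, rfl⟩ := (hjc.exact y).1 h0
      obtain ⟨w, rfl⟩ := h.surjective z
      refine ⟨w + f.hom (x - r.hom w), ?_⟩
      simp [hr', h.comp_eq_zero]
    · rintro ⟨w, hw⟩
      rw [← hw]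
      exact hjc.comp_eq_zero _
  · intro y
    obtain ⟨x, rfl⟩ := hjc.surjective y
    exact ⟨(0, x), rfl⟩

theorem isSyzygy_succ_of_projStep {n : ℕ} {M N K : ModuleCat.{u} A} (hN : ProjStep N M)
    (hK : IsSyzygy n N K) : IsSyzygy (n + 1) M K := by
  induction n generalizing K with
  | zero =>
    obtain ⟨e⟩ := hK
    exact isSyzygy_succ_iff.2 ⟨M, hN.congr e (Iso.refl _), ⟨Iso.refl _⟩⟩
  | succ n ih =>
    obtain ⟨L, hL, h⟩ := isSyzygy_succ_iff.1 hK
    exact isSyzygy_succ_iff.2 ⟨L, hL, ih h⟩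

/-- A module whose `n`-th syzygies are Gorenstein-projective embeds in a module of projective
dimension at most `n` with Gorenstein-projective cokernel. -/
theorem exists_projDimLE_embedding (n : ℕ) (M : ModuleCat.{u} A)
    (h : ∀ K, IsSyzygy n M K → GProj A K) :
    ∃ (Y G : ModuleCat.{u} A) (f : M ⟶ Y) (g : Y ⟶ G),
      IsSES f g ∧ HasProjectiveDimensionLE Y n ∧ GProj A G := by
  induction n generalizing M with
  | zero =>
    obtain ⟨-, G, hG, Q, f, g, hfg, hQ⟩ := (h M ⟨Iso.refl _⟩).exists_projStep
    exact ⟨Q, G, f, g, hfg, (projective_iff_hasProjectiveDimensionLE_zero Q).1 hQ, hG⟩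
  | succ n ih =>
    obtain ⟨N, hN⟩ := exists_projStep M
    obtain ⟨Y, G, a, c, hac, hY, hG⟩ := ih N fun K hK => h K (isSyzygy_succ_of_projStep hN hK)
    obtain ⟨P, i, p, hip, hP⟩ := hN
    obtain ⟨W, f₁, g₁, f₂, g₂, h₁, h₂⟩ := exists_pushout_ses hip hac
    obtain ⟨-, W', hW', Q, j, q, hjq, hQ⟩ :=
      (gproj_of_extension_by_projective h₂ hP hG).exists_projStep
    obtain ⟨Z, g₃, f₄, g₄, h₃, h₄⟩ := exists_quotient_ses h₁ hjq
    exact ⟨Z, W', f₄, g₄, h₄, h₃.2.hasProjectiveDimensionLT_X₃ (n + 1) hY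
      (have : HasProjectiveDimensionLT Q 1 := inferInstance
       hasProjectiveDimensionLT_of_ge Q 1 _ (by omega)), hW'⟩

section Gorenstein

variable {d : ℕ}

theorem projPerp_of_syzygies
    (hP : ∀ P : ModuleCat.{u} A, Projective P → HasInjectiveDimensionLE P d)
    {K : ModuleCat.{u} A} (hK : syzygies A d K) : projPerp A K := by
  obtain ⟨M, hM⟩ := hK
  intro Q hQ i hi
  have := hP Q hQ
  exact (hM.ext_iff Q hi).2 (HasInjectiveDimensionLT.subsingleton Q (d + 1) _ (by omega) M)

theorem gproj_eq_syzygies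
    (hP : ∀ P : ModuleCat.{u} A, Projective P → HasInjectiveDimensionLE P d)
    (hI : ∀ I : ModuleCat.{u} A, Injective I → HasProjectiveDimensionLE I d) :
    GProj A = syzygies A d := by
  ext K
  constructor
  · intro hK
    obtain ⟨G, -, h⟩ := hK.exists_isSyzygy d
    exact ⟨G, h⟩
  · refine gproj_of_coinductive (syzygies A d) fun K hK => ⟨projPerp_of_syzygies hP hK, ?_⟩
    obtain ⟨M, hM⟩ := hK
    obtain ⟨N, I, f, g, hfg, hI'⟩ := exists_injStep M
    obtain ⟨J, L, a, c, hac, hJ, hL⟩ := hM.exists_horseshoe hfg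
    exact ⟨L, ⟨N, hL⟩, J, a, c, hac, hJ.projective_iff.1 (hI I hI')⟩

theorem injectiveDimension_of_gproj_eq_syzygies (h : GProj A = syzygies A d)
    (P : ModuleCat.{u} A) (hP : Projective P) : HasInjectiveDimensionLE P d := by
  refine HasInjectiveDimensionLT.mk fun i hi Y e => ?_
  obtain ⟨K, hK⟩ := exists_isSyzygy d Y
  have hK' : GProj A K := by rw [h]; exact ⟨Y, hK⟩
  have := (hK.ext_iff P (i := i - d) (by omega)).1 (hK'.projPerp P hP _ (by omega))
  rw [Nat.sub_add_cancel (by omega)] at this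
  exact Subsingleton.elim _ _

theorem projectiveDimension_of_gproj_eq_syzygies (h : GProj A = syzygies A d)
    (I : ModuleCat.{u} A) (hI : Injective I) : HasProjectiveDimensionLE I d := by
  obtain ⟨K, hK⟩ := exists_isSyzygy d I
  have hK' : GProj A K := by rw [h]; exact ⟨I, hK⟩
  obtain ⟨-, Y, hY, Q, f, g, hfg, hQ⟩ := hK'.exists_projStep
  obtain ⟨G, hG, hGY⟩ := hY.exists_isSyzygy d
  have hext : Subsingleton (Abelian.Ext Y K 1) := (hGY.ext_iff K le_rfl).2
    (hK.ext_perp hG.projPerp le_rfl (subsingleton_ext_of_injective G I le_rfl))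
  obtain ⟨r, hr⟩ := exists_extension_of_ext_one hfg.2 hext (𝟙 K)
  exact hK.projective_iff.2 (Retract.projective (Y := Q) ⟨f, r, hr⟩)

theorem gproj_eq_projPerp
    (hP : ∀ P : ModuleCat.{u} A, Projective P → HasInjectiveDimensionLE P d)
    (hI : ∀ I : ModuleCat.{u} A, Injective I → HasProjectiveDimensionLE I d) :
    GProj A = projPerp A := by
  ext M
  refine ⟨fun h => h.projPerp, fun hM => ?_⟩
  obtain ⟨Y, G, f, g, hfg, hY, hG⟩ := exists_projDimLE_embedding d M fun K hK => by
    rw [gproj_eq_syzygies hP hI]; exact ⟨M, hK⟩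
  have hYp : projPerp A Y := projPerp_of_extension hfg.2 hM hG.projPerp
  exact gproj_of_projStep hM ⟨Y, f, g, hfg, hYp.projective hY⟩ hG

theorem isCotorsionPair_gproj
    (hP : ∀ P : ModuleCat.{u} A, Projective P → HasInjectiveDimensionLE P d)
    (hI : ∀ I : ModuleCat.{u} A, Injective I → HasProjectiveDimensionLE I d) :
    IsCotorsionPair (GProj A) (projDimLE A d) := by
  have hsyz : ∀ M K : ModuleCat.{u} A, IsSyzygy d M K → GProj A K := fun M K hK => by
    rw [gproj_eq_syzygies hP hI]; exact ⟨M, hK⟩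
  have heq := gproj_eq_projPerp hP hI
  refine ⟨?_, projDimLE_isClosedUnderFiniteProducts d, ?_, projDimLE_isStableUnderRetracts d,
    fun X Y hX hY => hX.projPerp.ext_projDimLE hY le_rfl, fun M => ?_, fun M => ?_⟩
  · rw [heq]; exact projPerp_isClosedUnderFiniteProducts
  · rw [heq]; exact projPerp_isStableUnderRetracts
  · obtain ⟨N, P, i, p, hip, hP'⟩ := exists_projStep M
    obtain ⟨Y, G, a, c, hac, hY, hG⟩ := exists_projDimLE_embedding d N (hsyz N)
    obtain ⟨W, f₁, g₁, f₂, g₂, h₁, h₂⟩ := exists_pushout_ses hip hac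
    exact ⟨_, h₁.2, hY, gproj_of_extension_by_projective h₂ hP' hG, ⟨Iso.refl _⟩⟩
  · obtain ⟨Y, G, f, g, hfg, hY, hG⟩ := exists_projDimLE_embedding d M (hsyz M)
    exact ⟨_, hfg.2, ⟨Iso.refl _⟩, hY, hG⟩

end Gorenstein

end Projective

section Injective

variable {A : Type u} [Ring A]

theorem injPerp_isStableUnderRetracts : (injPerp A).IsStableUnderRetracts :=
  ⟨fun r h Q hQ i hi => subsingleton_ext_of_retract_right r (h Q hQ i hi)⟩

theorem injPerp_of_injective (J : ModuleCat.{u} A) [Injective J] : injPerp A J :=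
  fun Q _ _ hi => subsingleton_ext_of_injective Q J hi

theorem injPerp_of_extension {S : ShortComplex (ModuleCat.{u} A)} (hS : S.ShortExact)
    (h₁ : injPerp A S.X₁) (h₃ : injPerp A S.X₃) : injPerp A S.X₂ := fun Q hQ i hi =>
  subsingleton_ext_into_X₂ hS (h₁ Q hQ i hi) (h₃ Q hQ i hi)

theorem injPerp_isClosedUnderFiniteProducts : (injPerp A).IsClosedUnderFiniteProducts :=
  isClosedUnderFiniteProducts_of_extensions _
    (fun Z hZ => have := hZ.injective; injPerp_of_injective Z)
    injPerp_isStableUnderRetracts (fun _ hS => injPerp_of_extension hS)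

theorem injDimLE_isStableUnderRetracts (d : ℕ) : (injDimLE A d).IsStableUnderRetracts :=
  ⟨fun r h => have : HasInjectiveDimensionLE _ d := h; r.hasInjectiveDimensionLT _⟩

theorem injDimLE_isClosedUnderFiniteProducts (d : ℕ) :
    (injDimLE A d).IsClosedUnderFiniteProducts :=
  isClosedUnderFiniteProducts_of_extensions _
    (fun Z hZ => have := hZ.hasInjectiveDimensionLT_zero; hasInjectiveDimensionLT_of_ge Z 0 _
      (Nat.zero_le _))
    (injDimLE_isStableUnderRetracts d) (fun _ hS => hS.hasInjectiveDimensionLT_X₂ _)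

/-- Modules orthogonal to injective modules are orthogonal to modules of finite injective
dimension. -/
theorem injPerp.ext_injDimLE {X Y : ModuleCat.{u} A} (hX : injPerp A X) {n : ℕ}
    (hY : HasInjectiveDimensionLE Y n) {i : ℕ} (hi : 1 ≤ i) :
    Subsingleton (Abelian.Ext Y X i) := by
  induction n generalizing Y i with
  | zero => exact hX Y (injective_iff_hasInjectiveDimensionLT_one.2 hY) i hi
  | succ n ih =>
    obtain ⟨K, hK⟩ := exists_injStep Y
    have hKn := (hK.hasInjectiveDimensionLE_iff n).1 hY
    obtain ⟨Q, f, g, h, hQ⟩ := hK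
    exact subsingleton_ext_X₁ h.2 (hX Q hQ i hi) (ih hKn (by omega))

theorem injPerp.injective {X : ModuleCat.{u} A} (hX : injPerp A X) {n : ℕ}
    (hn : HasInjectiveDimensionLE X n) : Injective X := by
  obtain ⟨K, hK⟩ := exists_injStep X
  have hKn : HasInjectiveDimensionLE K n :=
    (hK.hasInjectiveDimensionLE_iff n).1 (hasInjectiveDimensionLT_of_ge X (n + 1) _ (by omega))
  obtain ⟨Q, f, g, h, hQ⟩ := hK
  obtain ⟨s, hs⟩ := exists_extension_of_ext_one h.2 (hX.ext_injDimLE hKn le_rfl) (𝟙 X)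
  exact Retract.injective (Y := Q) ⟨f, s, hs⟩

theorem GInj.injPerp {M : ModuleCat.{u} A} (hM : GInj A M) : injPerp A M :=
  hM.exists_injStep.1

theorem GInj.exists_isCosyzygy {M : ModuleCat.{u} A} (hM : GInj A M) (n : ℕ) :
    ∃ G, GInj A G ∧ IsCosyzygy n G M := by
  induction n generalizing M with
  | zero => exact ⟨M, hM, ⟨Iso.refl _⟩⟩
  | succ n ih =>
    obtain ⟨-, Y, hY, h⟩ := hM.exists_injStep
    obtain ⟨G, hG, h'⟩ := ih hY
    exact ⟨G, hG, isCosyzygy_succ_iff.2 ⟨Y, h, h'⟩⟩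

/-- A module that is orthogonal to injectives and has a Gorenstein-injective syzygy is
Gorenstein-injective. -/
theorem ginj_of_injStep {M Y : ModuleCat.{u} A} (hM : injPerp A M) (h : InjStep Y M)
    (hY : GInj A Y) : GInj A M := by
  refine ginj_of_coinductive (fun X => GInj A X ∨ X = M) ?_ (Or.inr rfl)
  rintro X (hX | rfl)
  · obtain ⟨h, Z, hZ, h'⟩ := hX.exists_injStep
    exact ⟨h, Z, Or.inl hZ, h'⟩
  · exact ⟨hM, Y, Or.inl hY, h⟩

theorem injective_prod (P Q : ModuleCat.{u} A) [Injective P] [Injective Q] :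
    Injective (ModuleCat.of A (P × Q)) :=
  Injective.of_iso (ModuleCat.biprodIsoProd P Q) inferInstance

theorem ginj_of_extension_of_injective {G W I : ModuleCat.{u} A} {f : G ⟶ W} {g : W ⟶ I}
    (h : IsSES f g) (hI : Injective I) (hG : GInj A G) : GInj A W := by
  obtain ⟨hG', Y, hY, Q, j, c, hjc, hQ⟩ := hG.exists_injStep
  have hW : injPerp A W := injPerp_of_extension h.2 hG' (injPerp_of_injective I)
  obtain ⟨s, hs⟩ := exists_lift_of_ext_one h.2 (hG' I hI 1 le_rfl) (𝟙 I)
  have hs' : ∀ x, g.hom (s.hom x) = x := fun x => congrArg (fun φ => φ.hom x) hs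
  refine ginj_of_injStep hW ⟨ModuleCat.of A (Q × I),
    ModuleCat.ofHom (LinearMap.inl A Q I ∘ₗ j.hom),
    ModuleCat.ofHom ((f.hom ∘ₗ c.hom).coprod s.hom), IsSES.mk ?_ ?_ ?_, injective_prod Q I⟩ hY
  · exact LinearMap.inl_injective.comp hjc.injective
  · rintro ⟨x, y⟩
    constructor
    · intro h0
      have h1 : f.hom (c.hom x) + s.hom y = 0 := h0
      have h2 : y = 0 := by
        have := congrArg g.hom h1
        rwa [map_add, h.comp_eq_zero, zero_add, hs', map_zero] at this
      subst h2
      rw [map_zero, add_zero] at h1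
      obtain ⟨z, rfl⟩ := (hjc.exact x).1 (h.injective (h1.trans (map_zero _).symm))
      exact ⟨z, rfl⟩
    · rintro ⟨w, hw⟩
      rw [← hw]
      change f.hom (c.hom (j.hom w)) + s.hom 0 = 0
      rw [hjc.comp_eq_zero, map_zero, map_zero, add_zero]
  · intro w
    obtain ⟨z, hz⟩ := (h.exact (w - s.hom (g.hom w))).1 (by rw [map_sub, hs', sub_self])
    obtain ⟨x, rfl⟩ := hjc.surjective z
    exact ⟨(x, g.hom w), by
      change f.hom (c.hom x) + s.hom (g.hom w) = w
      rw [hz, sub_add_cancel]⟩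

theorem isCosyzygy_succ_of_injStep {n : ℕ} {M N K : ModuleCat.{u} A} (hN : InjStep M N)
    (hK : IsCosyzygy n N K) : IsCosyzygy (n + 1) M K := by
  induction n generalizing K with
  | zero =>
    obtain ⟨e⟩ := hK
    exact isCosyzygy_succ_iff.2 ⟨M, hN.congr (Iso.refl _) e, ⟨Iso.refl _⟩⟩
  | succ n ih =>
    obtain ⟨L, hL, h⟩ := isCosyzygy_succ_iff.1 hK
    exact isCosyzygy_succ_iff.2 ⟨L, hL, ih h⟩

/-- A module whose `n`-th cosyzygies are Gorenstein-injective is a quotient of a module of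
injective dimension at most `n` with Gorenstein-injective kernel. -/
theorem exists_injDimLE_cover (n : ℕ) (M : ModuleCat.{u} A)
    (h : ∀ K, IsCosyzygy n M K → GInj A K) :
    ∃ (G Y : ModuleCat.{u} A) (f : G ⟶ Y) (g : Y ⟶ M),
      IsSES f g ∧ HasInjectiveDimensionLE Y n ∧ GInj A G := by
  induction n generalizing M with
  | zero =>
    obtain ⟨-, G, hG, Q, f, g, hfg, hQ⟩ := (h M ⟨Iso.refl _⟩).exists_injStep
    exact ⟨G, Q, f, g, hfg, injective_iff_hasInjectiveDimensionLT_one.1 hQ, hG⟩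
  | succ n ih =>
    obtain ⟨N, hN⟩ := exists_injStep M
    obtain ⟨G, Y, a, c, hac, hY, hG⟩ := ih N fun K hK => h K (isCosyzygy_succ_of_injStep hN hK)
    obtain ⟨P, i, p, hip, hP⟩ := hN
    obtain ⟨W, f₁, g₁, f₂, g₂, h₁, h₂⟩ := exists_pullback_ses hip hac
    obtain ⟨-, W', hW', Q, j, q, hjq, hQ⟩ :=
      (ginj_of_extension_of_injective h₁ hP hG).exists_injStep
    obtain ⟨Z, f₃, f₄, g₄, h₃, h₄⟩ := exists_kernel_ses h₂ hjq
    exact ⟨W', Z, f₄, g₄, h₄, h₃.2.hasInjectiveDimensionLT_X₁ (n + 1) hY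
      (have : HasInjectiveDimensionLT Q 1 := inferInstance
       hasInjectiveDimensionLT_of_ge Q 1 _ (by omega)), hW'⟩

section Gorenstein

variable {d : ℕ}

theorem injPerp_of_cosyzygies
    (hI : ∀ I : ModuleCat.{u} A, Injective I → HasProjectiveDimensionLE I d)
    {K : ModuleCat.{u} A} (hK : cosyzygies A d K) : injPerp A K := by
  obtain ⟨M, hM⟩ := hK
  intro Q hQ i hi
  have := hI Q hQ
  exact (hM.ext_iff Q hi).2 (HasProjectiveDimensionLT.subsingleton Q (d + 1) _ (by omega) M)

theorem ginj_eq_cosyzygies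
    (hP : ∀ P : ModuleCat.{u} A, Projective P → HasInjectiveDimensionLE P d)
    (hI : ∀ I : ModuleCat.{u} A, Injective I → HasProjectiveDimensionLE I d) :
    GInj A = cosyzygies A d := by
  ext K
  constructor
  · intro hK
    obtain ⟨G, -, h⟩ := hK.exists_isCosyzygy d
    exact ⟨G, h⟩
  · refine ginj_of_coinductive (cosyzygies A d) fun K hK => ⟨injPerp_of_cosyzygies hI hK, ?_⟩
    obtain ⟨M, hM⟩ := hK
    obtain ⟨N, P, f, g, hfg, hP'⟩ := exists_projStep M
    obtain ⟨L, J, a, c, hac, hJ, hL⟩ := hM.exists_cohorseshoe hfg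
    exact ⟨L, ⟨N, hL⟩, J, a, c, hac, hJ.injective_iff.1 (hP P hP')⟩

theorem projectiveDimension_of_ginj_eq_cosyzygies (h : GInj A = cosyzygies A d)
    (I : ModuleCat.{u} A) (hI : Injective I) : HasProjectiveDimensionLE I d := by
  refine HasProjectiveDimensionLT.mk fun i hi Y e => ?_
  obtain ⟨K, hK⟩ := exists_isCosyzygy d Y
  have hK' : GInj A K := by rw [h]; exact ⟨Y, hK⟩
  have := (hK.ext_iff I (i := i - d) (by omega)).1 (hK'.injPerp I hI _ (by omega))
  rw [Nat.sub_add_cancel (by omega)] at this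
  exact Subsingleton.elim _ _

theorem injectiveDimension_of_ginj_eq_cosyzygies (h : GInj A = cosyzygies A d)
    (P : ModuleCat.{u} A) (hP : Projective P) : HasInjectiveDimensionLE P d := by
  obtain ⟨K, hK⟩ := exists_isCosyzygy d P
  have hK' : GInj A K := by rw [h]; exact ⟨P, hK⟩
  obtain ⟨-, Y, hY, Q, f, g, hfg, hQ⟩ := hK'.exists_injStep
  obtain ⟨G, hG, hGY⟩ := hY.exists_isCosyzygy d
  have hext : Subsingleton (Abelian.Ext K Y 1) := (hGY.ext_iff K le_rfl).2
    (hK.ext_perp hG.injPerp le_rfl (subsingleton_ext_of_projective P G le_rfl))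
  obtain ⟨r, hr⟩ := exists_lift_of_ext_one hfg.2 hext (𝟙 K)
  exact hK.injective_iff.2 (Retract.injective (Y := Q) ⟨r, g, hr⟩)

theorem ginj_eq_injPerp
    (hP : ∀ P : ModuleCat.{u} A, Projective P → HasInjectiveDimensionLE P d)
    (hI : ∀ I : ModuleCat.{u} A, Injective I → HasProjectiveDimensionLE I d) :
    GInj A = injPerp A := by
  ext M
  refine ⟨fun h => h.injPerp, fun hM => ?_⟩
  obtain ⟨G, Y, f, g, hfg, hY, hG⟩ := exists_injDimLE_cover d M fun K hK => by
    rw [ginj_eq_cosyzygies hP hI]; exact ⟨M, hK⟩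
  have hYp : injPerp A Y := injPerp_of_extension hfg.2 hG.injPerp hM
  exact ginj_of_injStep hM ⟨Y, f, g, hfg, hYp.injective hY⟩ hG

theorem isCotorsionPair_ginj
    (hP : ∀ P : ModuleCat.{u} A, Projective P → HasInjectiveDimensionLE P d)
    (hI : ∀ I : ModuleCat.{u} A, Injective I → HasProjectiveDimensionLE I d) :
    IsCotorsionPair (injDimLE A d) (GInj A) := by
  have hcosyz : ∀ M K : ModuleCat.{u} A, IsCosyzygy d M K → GInj A K := fun M K hK => by
    rw [ginj_eq_cosyzygies hP hI]; exact ⟨M, hK⟩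
  have heq := ginj_eq_injPerp hP hI
  refine ⟨injDimLE_isClosedUnderFiniteProducts d, ?_, injDimLE_isStableUnderRetracts d, ?_,
    fun X Y hX hY => hY.injPerp.ext_injDimLE hX le_rfl, fun M => ?_, fun M => ?_⟩
  · rw [heq]; exact injPerp_isClosedUnderFiniteProducts
  · rw [heq]; exact injPerp_isStableUnderRetracts
  · obtain ⟨G, Y, f, g, hfg, hY, hG⟩ := exists_injDimLE_cover d M (hcosyz M)
    exact ⟨_, hfg.2, hG, hY, ⟨Iso.refl _⟩⟩
  · obtain ⟨N, P, i, p, hip, hP'⟩ := exists_injStep M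
    obtain ⟨G, Y, a, c, hac, hY, hG⟩ := exists_injDimLE_cover d N (hcosyz N)
    obtain ⟨W, f₁, g₁, f₂, g₂, h₁, h₂⟩ := exists_pullback_ses hip hac
    exact ⟨_, h₂.2, ⟨Iso.refl _⟩, ginj_of_extension_of_injective h₁ hP' hG, hY⟩

end Gorenstein

end Injective

section Matlis

variable {R : Type u} [CommRing R]

/-- An element of `E` killed by a maximal ideal `𝔪` lies in the copy of `R ⧸ 𝔪` in `E`. -/
theorem mem_range_of_forall_smul_eq_zero [DecidableEq (MaximalSpectrum R)]
    (𝔪 : MaximalSpectrum R) (x : minInjCogenerator R)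
    (hx : ∀ r ∈ 𝔪.asIdeal, r • x = 0) :
    ∃ a : R ⧸ 𝔪.asIdeal, minInjCogeneratorι R
      (DirectSum.lof R (MaximalSpectrum R) (fun 𝔪 => R ⧸ 𝔪.asIdeal) 𝔪 a) = x := by
  have hE := isInjectiveHull_minInjCogeneratorι R
  set ι := minInjCogeneratorι R
  have h𝔪 := 𝔪.isMaximal
  by_cases hx0 : x = 0
  · exact ⟨0, by rw [map_zero, map_zero, hx0]⟩
  have hne : Submodule.span R {x} ⊓ LinearMap.range ι ≠ ⊥ := fun h =>
    hx0 (Submodule.span_singleton_eq_bot.1 (hE.essential _ h))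
  obtain ⟨y, ⟨hy1, ⟨t, ht⟩⟩, hy0⟩ := Submodule.exists_mem_ne_zero_of_ne_bot hne
  obtain ⟨r, rfl⟩ := Submodule.mem_span_singleton.1 hy1
  have hr : r ∉ 𝔪.asIdeal := fun h => hy0 (hx r h)
  obtain ⟨s, hs⟩ := h𝔪.exists_inv hr
  obtain ⟨z, hz, hsz⟩ := hs
  have hxs : ι (s • t) = x := by
    rw [map_smul, ht, smul_smul]
    have h1 : (s * r + z) • x = x := by rw [hsz, one_smul]
    rwa [add_smul, hx z hz, add_zero] at h1
  set t' := s • t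
  have hkill : ∀ r ∈ 𝔪.asIdeal, r • t' = 0 := fun r hr => by
    apply hE.mono
    rw [map_smul, hxs, map_zero]
    exact hx r hr
  have hcomp : ∀ 𝔫 : MaximalSpectrum R, 𝔫 ≠ 𝔪 → t' 𝔫 = 0 := fun 𝔫 hn => by
    have h𝔫 := 𝔫.isMaximal
    have hnle : ¬ 𝔪.asIdeal ≤ 𝔫.asIdeal := fun hle =>
      hn (MaximalSpectrum.ext (h𝔪.eq_of_le h𝔫.ne_top hle).symm)
    obtain ⟨r, hr, hrn⟩ := Set.not_subset.1 hnle
    have h1 : r • t' 𝔫 = 0 := by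
      rw [← DirectSum.smul_apply, hkill r hr]; rfl
    obtain ⟨c, hc⟩ := Ideal.Quotient.mk_surjective (t' 𝔫)
    rw [← hc] at h1 ⊢
    rw [Ideal.Quotient.eq_zero_iff_mem]
    have h2 : Ideal.Quotient.mk 𝔫.asIdeal (r * c) = 0 := by
      rw [map_mul]; rw [Algebra.smul_def] at h1; exact h1
    rw [Ideal.Quotient.eq_zero_iff_mem] at h2
    exact (h𝔫.isPrime.mem_or_mem h2).resolve_left hrn
  refine ⟨t' 𝔪, ?_⟩
  rw [← hxs]
  congr 1
  refine DFinsupp.ext fun 𝔫 => ?_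
  by_cases h : 𝔫 = 𝔪
  · subst h
    exact DirectSum.of_eq_same (β := fun 𝔪 : MaximalSpectrum R => R ⧸ 𝔪.asIdeal) _ _
  · rw [show t' 𝔫 = 0 from hcomp 𝔫 h]
    exact DirectSum.of_eq_of_ne (β := fun 𝔪 : MaximalSpectrum R => R ⧸ 𝔪.asIdeal) _ _ _ h

theorem length_hom_simple_le (S : Type u) [AddCommGroup S] [Module R S] [hS : IsSimpleModule R S] :
    Module.length R (S →ₗ[R] minInjCogenerator R) ≤ 1 := by
  classical
  obtain ⟨I, hI, ⟨e⟩⟩ := isSimpleModule_iff_quot_maximal.1 hS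
  let 𝔪 : MaximalSpectrum R := ⟨I, hI⟩
  let j : (R ⧸ I) →ₗ[R] minInjCogenerator R := minInjCogeneratorι R ∘ₗ
    DirectSum.lof R (MaximalSpectrum R) (fun 𝔪 => R ⧸ 𝔪.asIdeal) 𝔪
  have hsimple : IsSimpleModule R (R ⧸ I) := isSimpleModule_iff_quot_maximal.2
    ⟨I, hI, ⟨LinearEquiv.refl R _⟩⟩
  let φ : (S →ₗ[R] minInjCogenerator R) →ₗ[R] LinearMap.range j :=
    (LinearMap.applyₗ (e.symm (Submodule.Quotient.mk 1))).codRestrict _ fun f =>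
      mem_range_of_forall_smul_eq_zero 𝔪 _ fun r hr => by
        change r • f (e.symm (Submodule.Quotient.mk 1)) = 0
        rw [← map_smul, ← map_smul, ← Submodule.Quotient.mk_smul,
          (Submodule.Quotient.mk_eq_zero I).2 (by simpa using hr), map_zero, map_zero]
  have hφ : Function.Injective φ := by
    intro f g hfg
    have h1 : f (e.symm (Submodule.Quotient.mk 1)) = g (e.symm (Submodule.Quotient.mk 1)) :=
      congrArg Subtype.val hfg
    ext s
    obtain ⟨q, rfl⟩ := e.symm.surjective s
    obtain ⟨r, rfl⟩ := Submodule.Quotient.mk_surjective _ q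
    have : (Submodule.Quotient.mk r : R ⧸ I) = r • Submodule.Quotient.mk 1 := by
      rw [← Submodule.Quotient.mk_smul, smul_eq_mul, mul_one]
    rw [this, map_smul, map_smul, map_smul, h1]
  calc Module.length R (S →ₗ[R] minInjCogenerator R)
      ≤ Module.length R (LinearMap.range j) := Module.length_le_of_injective φ hφ
    _ ≤ Module.length R (R ⧸ I) := Module.length_le_of_surjective _ j.surjective_rangeRestrict
    _ = 1 := Module.length_eq_one R _

theorem length_hom_le {M : Type u} [AddCommGroup M] [Module R M] (hM : IsFiniteLength R M) :
    Module.length R (M →ₗ[R] minInjCogenerator R) ≤ Module.length R M := by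
  induction hM with
  | of_subsingleton => simp
  | @of_simple_quotient M _ _ N _ _ ih =>
    let ρ : (M →ₗ[R] minInjCogenerator R) →ₗ[R] (N →ₗ[R] minInjCogenerator R) :=
      LinearMap.lcomp R _ N.subtype
    let q : ((M ⧸ N) →ₗ[R] minInjCogenerator R) →ₗ[R] (M →ₗ[R] minInjCogenerator R) :=
      LinearMap.lcomp R _ N.mkQ
    have hq : LinearMap.ker ρ ≤ LinearMap.range q := fun f hf =>
      ⟨N.liftQ f fun x hx => LinearMap.congr_fun hf ⟨x, hx⟩, LinearMap.ext fun x => rfl⟩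
    have h1 : Module.length R (LinearMap.ker ρ) ≤ 1 :=
      calc Module.length R (LinearMap.ker ρ)
          ≤ Module.length R (LinearMap.range q) :=
            Module.length_le_of_injective _ (Submodule.inclusion_injective hq)
        _ ≤ Module.length R ((M ⧸ N) →ₗ[R] minInjCogenerator R) :=
            Module.length_le_of_surjective _ q.surjective_rangeRestrict
        _ ≤ 1 := length_hom_simple_le _
    have h2 : Module.length R (LinearMap.range ρ) ≤ Module.length R N :=
      (Module.length_le_of_injective _ (LinearMap.range ρ).subtype_injective).trans ih
    have h3 : Module.length R M = Module.length R N + 1 := by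
      rw [Module.length_eq_add_of_exact N.subtype N.mkQ N.subtype_injective N.mkQ_surjective
        (LinearMap.exact_subtype_mkQ N), Module.length_eq_one R (M ⧸ N)]
    rw [h3, Module.length_eq_add_of_exact (LinearMap.ker ρ).subtype ρ.rangeRestrict
      (LinearMap.ker ρ).subtype_injective ρ.surjective_rangeRestrict (by
        rw [LinearMap.exact_iff, LinearMap.ker_rangeRestrict, Submodule.range_subtype]), add_comm]
    exact add_le_add h2 h1

theorem isFiniteLength_hom {M : Type u} [AddCommGroup M] [Module R M] (hM : IsFiniteLength R M) :
    IsFiniteLength R (M →ₗ[R] minInjCogenerator R) := by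
  rw [← Module.length_ne_top_iff] at hM ⊢
  exact ne_top_of_le_ne_top hM (length_hom_le (Module.length_ne_top_iff.1 hM))

/-- Matlis duality: a module of finite length is reflexive. -/
theorem matlis_bijective {M : Type u} [AddCommGroup M] [Module R M] (hM : IsFiniteLength R M) :
    Function.Bijective
      (LinearMap.applyₗ : M →ₗ[R] (M →ₗ[R] minInjCogenerator R) →ₗ[R] minInjCogenerator R) := by
  set ev : M →ₗ[R] (M →ₗ[R] minInjCogenerator R) →ₗ[R] minInjCogenerator R := LinearMap.applyₗ
  have hinj : Function.Injective ev := by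
    rw [injective_iff_map_eq_zero]
    intro x hx
    by_contra hx0
    obtain ⟨f, hf⟩ :=
      (isMinimalInjectiveCogenerator_minInjCogenerator R).isCogenerator M x hx0
    exact hf (LinearMap.congr_fun hx f)
  refine ⟨hinj, ?_⟩
  have hle : Module.length R ((M →ₗ[R] minInjCogenerator R) →ₗ[R] minInjCogenerator R) ≤
      Module.length R M := (length_hom_le (isFiniteLength_hom hM)).trans (length_hom_le hM)
  have hadd := Module.length_eq_add_of_exact ev (LinearMap.range ev).mkQ hinj
    (Submodule.mkQ_surjective _) (LinearMap.exact_map_mkQ_range ev)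
  rw [hadd] at hle
  have h0 : Module.length R
      (((M →ₗ[R] minInjCogenerator R) →ₗ[R] minInjCogenerator R) ⧸ LinearMap.range ev) = 0 := by
    have hfin := Module.length_ne_top_iff.2 hM
    have h1 := (ENat.add_le_add_iff_left hfin).1 (hle.trans (add_zero _).symm.le)
    exact nonpos_iff_eq_zero.1 h1
  rw [Module.length_eq_zero_iff, Submodule.Quotient.subsingleton_iff] at h0
  exact LinearMap.range_eq_top.1 h0

end Matlis

section DualBimodule

variable (R A : Type u) [CommRing R] [Ring A] [Algebra R A]

/-- The bimodule `Hom_R(A, E)`: `A` acts by `(a • f) x = f (x * a)` and `Aᵐᵒᵖ` acts by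
`(op a • f) x = f (a * x)`. -/
def DualBimodule : Type u := A →ₗ[R] minInjCogenerator R

namespace DualBimodule

instance : AddCommGroup (DualBimodule R A) :=
  inferInstanceAs (AddCommGroup (A →ₗ[R] minInjCogenerator R))

instance : FunLike (DualBimodule R A) A (minInjCogenerator R) :=
  inferInstanceAs (FunLike (A →ₗ[R] minInjCogenerator R) A (minInjCogenerator R))

instance : LinearMapClass (DualBimodule R A) R A (minInjCogenerator R) :=
  inferInstanceAs (LinearMapClass (A →ₗ[R] minInjCogenerator R) R A (minInjCogenerator R))

variable {R A}

@[ext] theorem ext {f g : DualBimodule R A} (h : ∀ x, f x = g x) : f = g := DFunLike.ext f g h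

@[simp] theorem add_apply (f g : DualBimodule R A) (x : A) : (f + g) x = f x + g x := rfl

@[simp] theorem zero_apply (x : A) : (0 : DualBimodule R A) x = 0 := rfl

instance : Module A (DualBimodule R A) where
  smul a f := LinearMap.comp (M₃ := minInjCogenerator R) f (LinearMap.mulRight R a)
  one_smul f := ext fun x => congrArg f (mul_one x)
  mul_smul a b f := ext fun x => congrArg f (mul_assoc x a b).symm
  smul_zero _ := rfl
  smul_add _ _ _ := rfl
  add_smul a b f := ext fun x => (congrArg f (mul_add x a b)).trans (map_add f _ _)
  zero_smul f := ext fun x => (congrArg f (mul_zero x)).trans (map_zero f)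

instance : Module Aᵐᵒᵖ (DualBimodule R A) where
  smul a f := LinearMap.comp (M₃ := minInjCogenerator R) f (LinearMap.mulLeft R a.unop)
  one_smul f := ext fun x => congrArg f (one_mul x)
  mul_smul a b f := ext fun x => congrArg f (mul_assoc b.unop a.unop x)
  smul_zero _ := rfl
  smul_add _ _ _ := rfl
  add_smul a b f := ext fun x => (congrArg f (add_mul a.unop b.unop x)).trans (map_add f _ _)
  zero_smul f := ext fun x => (congrArg f (zero_mul x)).trans (map_zero f)

@[simp] theorem smul_apply (a : A) (f : DualBimodule R A) (x : A) : (a • f) x = f (x * a) := rfl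

@[simp] theorem op_smul_apply (a : Aᵐᵒᵖ) (f : DualBimodule R A) (x : A) :
    (a • f) x = f (a.unop * x) := rfl

instance : SMulCommClass A Aᵐᵒᵖ (DualBimodule R A) :=
  ⟨fun a b f => ext fun x => congrArg f (mul_assoc b.unop x a).symm⟩

instance : SMulCommClass Aᵐᵒᵖ A (DualBimodule R A) := SMulCommClass.symm _ _ _

theorem algebraMap_smul_apply (r : R) (f : DualBimodule R A) (x : A) :
    (algebraMap R A r • f) x = r • f x := by
  rw [smul_apply, ← Algebra.commutes, ← Algebra.smul_def, map_smul]

instance injective : Module.Injective A (DualBimodule R A) := by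
  refine Module.Baer.injective fun I g => ?_
  have hE := (isMinimalInjectiveCogenerator_minInjCogenerator R).isInjective
  let φ : I →ₗ[R] minInjCogenerator R :=
    { toFun := fun x => g x 1
      map_add' := fun x y => by rw [map_add, add_apply]
      map_smul' := fun r x => by
        rw [← algebraMap_smul A r x, map_smul, algebraMap_smul_apply, RingHom.id_apply] }
  obtain ⟨ψ, hψ⟩ := Module.Injective.extension_property R (minInjCogenerator R) I A
    (I.subtype.restrictScalars R) I.subtype_injective φ
  refine ⟨LinearMap.toSpanSingleton A (DualBimodule R A) ψ, fun x hx => ext fun y => ?_⟩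
  have h1 := LinearMap.congr_fun hψ (y • ⟨x, hx⟩ : I)
  have h2 : φ (y • ⟨x, hx⟩) = g ⟨x, hx⟩ y := by
    change g (y • ⟨x, hx⟩) 1 = _
    rw [map_smul, smul_apply, one_mul]
  exact h1.trans h2

instance op_injective : Module.Injective Aᵐᵒᵖ (DualBimodule R A) := by
  refine Module.Baer.injective fun I g => ?_
  have hE := (isMinimalInjectiveCogenerator_minInjCogenerator R).isInjective
  let φ : I →ₗ[R] minInjCogenerator R :=
    { toFun := fun x => g x 1
      map_add' := fun x y => by rw [map_add, add_apply]
      map_smul' := fun r x => by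
        rw [← algebraMap_smul Aᵐᵒᵖ r x, map_smul, op_smul_apply, RingHom.id_apply,
          MulOpposite.algebraMap_apply, MulOpposite.unop_op, ← Algebra.smul_def, map_smul] }
  obtain ⟨ψ, hψ⟩ := Module.Injective.extension_property R (minInjCogenerator R) I Aᵐᵒᵖ
    (I.subtype.restrictScalars R) I.subtype_injective φ
  let ψ' : DualBimodule R A :=
    LinearMap.comp (M₃ := minInjCogenerator R) ψ (MulOpposite.opLinearEquiv R).toLinearMap
  refine ⟨LinearMap.toSpanSingleton Aᵐᵒᵖ (DualBimodule R A) ψ', fun x hx => ext fun y => ?_⟩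
  have h1 := LinearMap.congr_fun hψ (MulOpposite.op y • ⟨x, hx⟩ : I)
  have h2 : φ (MulOpposite.op y • ⟨x, hx⟩) = g ⟨x, hx⟩ y := by
    change g (MulOpposite.op y • ⟨x, hx⟩) 1 = _
    rw [map_smul, op_smul_apply, mul_one, MulOpposite.unop_op]
  exact h1.trans h2

/-- Homomorphisms to the dual bimodule separate points. -/
theorem exists_hom_apply_ne_zero {X : Type u} [AddCommGroup X] [Module A X] {x : X} (hx : x ≠ 0) :
    ∃ f : X →ₗ[A] DualBimodule R A, f x ≠ 0 := by
  let _ : Module R X := Module.compHom X (algebraMap R A)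
  have hsmul : ∀ (r : R) (y : X), r • y = algebraMap R A r • y := fun _ _ => rfl
  obtain ⟨φ, hφ⟩ := (isMinimalInjectiveCogenerator_minInjCogenerator R).isCogenerator X x hx
  let ψ : X → DualBimodule R A := fun y => show A →ₗ[R] minInjCogenerator R from
    { toFun := fun a => φ (a • y)
      map_add' := fun a b => by rw [add_smul, map_add]
      map_smul' := fun r a => by
        rw [Algebra.smul_def, mul_smul, ← hsmul, map_smul, RingHom.id_apply] }
  have hψ : ∀ y a, ψ y a = φ (a • y) := fun _ _ => rfl
  refine ⟨{ toFun := ψ, map_add' := fun y z => ext fun a => ?_,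
            map_smul' := fun b y => ext fun a => ?_ }, fun h => hφ ?_⟩
  · rw [add_apply, hψ, hψ, hψ, smul_add, map_add]
  · rw [RingHom.id_apply, smul_apply, hψ, hψ, mul_smul]
  · have h1 : ψ x 1 = 0 := by
      change ψ x = 0 at h
      rw [h, zero_apply]
    rwa [hψ, one_smul] at h1

theorem eq_of_forall_apply_eq {a b : A} (h : ∀ f : DualBimodule R A, f a = f b) : a = b := by
  by_contra hab
  obtain ⟨f, hf⟩ := (isMinimalInjectiveCogenerator_minInjCogenerator R).isCogenerator A (a - b)
    (sub_ne_zero.2 hab)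
  exact hf (by rw [map_sub, sub_eq_zero]; exact h f)

variable [IsArtinianRing R] [Module.Finite R A]

theorem isFiniteLength_of_finite (M : Type u) [AddCommGroup M] [Module R M] [Module.Finite R M] :
    IsFiniteLength R M :=
  isFiniteLength_iff_isNoetherian_isArtinian.2 ⟨inferInstance, inferInstance⟩

theorem exists_eval (φ : DualBimodule R A → minInjCogenerator R)
    (hadd : ∀ f g, φ (f + g) = φ f + φ g)
    (hsmul : ∀ (r : R) f, φ (algebraMap R A r • f) = r • φ f) :
    ∃ a : A, ∀ f : DualBimodule R A, f a = φ f := by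
  obtain ⟨a, ha⟩ := (matlis_bijective (isFiniteLength_of_finite (R := R) A)).2
    { toFun := φ
      map_add' := hadd
      map_smul' := fun r f => Eq.trans
        (congrArg φ (ext fun x => (algebraMap_smul_apply r f x).symm)) (hsmul r f) }
  exact ⟨a, fun f => LinearMap.congr_fun ha f⟩

/-- Every left endomorphism of the dual bimodule is right multiplication by an element. -/
theorem exists_eq_op_smul (φ : DualBimodule R A →ₗ[A] DualBimodule R A) :
    ∃ a : A, ∀ f, φ f = MulOpposite.op a • f := by
  obtain ⟨a, ha⟩ := exists_eval (R := R) (fun f : DualBimodule R A => φ f 1)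
    (fun f g => by rw [map_add, add_apply])
    (fun r f => by rw [map_smul, algebraMap_smul_apply])
  refine ⟨a, fun f => ext fun x => ?_⟩
  have := ha (x • f)
  rw [smul_apply, map_smul, smul_apply, one_mul] at this
  rw [← this, op_smul_apply, MulOpposite.unop_op]

/-- Every right endomorphism of the dual bimodule is left multiplication by an element. -/
theorem exists_eq_smul (φ : DualBimodule R A →ₗ[Aᵐᵒᵖ] DualBimodule R A) :
    ∃ a : A, ∀ f, φ f = a • f := by
  have hr : ∀ (r : R) (f : DualBimodule R A),
      algebraMap R A r • f = MulOpposite.op (algebraMap R A r) • f := fun r f => ext fun x => by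
    rw [smul_apply, op_smul_apply, MulOpposite.unop_op, Algebra.commutes]
  obtain ⟨a, ha⟩ := exists_eval (R := R) (fun f : DualBimodule R A => φ f 1)
    (fun f g => by rw [map_add, add_apply])
    (fun r f => by rw [hr, map_smul, ← hr, algebraMap_smul_apply])
  refine ⟨a, fun f => ext fun x => ?_⟩
  have := ha (MulOpposite.op x • f)
  rw [op_smul_apply, map_smul, op_smul_apply, MulOpposite.unop_op, mul_one] at this
  rw [← this, smul_apply]

/-- The regular right module is the dual of the left module `Hom_R(A, E)`. -/
def regularEquiv : A ≃ₗ[Aᵐᵒᵖ] (DualBimodule R A →ₗ[A] DualBimodule R A) :=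
  LinearEquiv.ofBijective
    { toFun := fun a => Module.toModuleEnd A (S := Aᵐᵒᵖ) (DualBimodule R A) (MulOpposite.op a)
      map_add' := fun a b => by rw [MulOpposite.op_add, map_add]
      map_smul' := fun b a => LinearMap.ext fun f => ext fun x => by
        change f (a * b.unop * x) = f (a * (b.unop * x))
        rw [mul_assoc] }
    ⟨fun a b hab => eq_of_forall_apply_eq (R := R) fun f => by
      have := congrArg (fun g : DualBimodule R A => g 1) (LinearMap.congr_fun hab f)
      change f (a * 1) = f (b * 1) at this
      rwa [mul_one, mul_one] at this,
    fun φ => by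
      obtain ⟨a, ha⟩ := exists_eq_op_smul φ
      exact ⟨a, LinearMap.ext fun f => (ha f).symm⟩⟩

instance finite : Module.Finite A (DualBimodule R A) := by
  have h := (isFiniteLength_iff_isNoetherian_isArtinian.1
    (isFiniteLength_hom (isFiniteLength_of_finite (R := R) A))).1
  obtain ⟨s, hs⟩ := (inferInstance : Module.Finite R (A →ₗ[R] minInjCogenerator R))
  let t : Finset (DualBimodule R A) := s
  refine ⟨⟨t, ?_⟩⟩
  have key : ∀ g ∈ Submodule.span R (s : Set (A →ₗ[R] minInjCogenerator R)),
      (show DualBimodule R A from g) ∈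
        Submodule.span A (t : Set (DualBimodule R A)) := by
    intro g hg
    induction hg using Submodule.span_induction with
    | mem x hx => exact Submodule.subset_span hx
    | zero => exact Submodule.zero_mem _
    | add x y _ _ hx hy => exact Submodule.add_mem _ hx hy
    | smul r x _ hx =>
      have : (show DualBimodule R A from r • x) =
          algebraMap R A r • (show DualBimodule R A from x) :=
        (ext fun y => algebraMap_smul_apply r _ y).symm
      rw [this]
      exact Submodule.smul_mem _ _ hx
  exact Submodule.eq_top_iff'.2 fun f => key f (by rw [hs]; trivial)

end DualBimodule

/-- The module `DA` is the dual bimodule. -/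
def dualModuleEquiv : dualModule R A ≃ₗ[A] DualBimodule R A :=
  { toFun := fun f => show A →ₗ[R] minInjCogenerator R from
      { toFun := fun x => (ModuleCat.CoextendScalars.equiv (algebraMap R A)
          (minInjCogenerator R) f) x
        map_add' := fun x y => map_add _ _ _
        map_smul' := fun r x => by
          rw [Algebra.smul_def]
          exact LinearMap.map_smul (ModuleCat.CoextendScalars.equiv (algebraMap R A)
            (minInjCogenerator R) f) r x }
    map_add' := fun f g => rfl
    map_smul' := fun a f => rfl
    invFun := fun f => (ModuleCat.CoextendScalars.equiv (algebraMap R A)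
          (minInjCogenerator R)).symm
      { toFun := fun x => f x
        map_add' := fun x y => map_add f _ _
        map_smul' := fun r x => by
          have h : f (algebraMap R A r * (show A from x)) = r • f (show A from x) := by
            rw [← Algebra.smul_def, map_smul]
          exact h }
    left_inv := fun f => rfl
    right_inv := fun f => rfl }

end DualBimodule

section Duality

variable (R : Type u) {A : Type u} [CommRing R] [Ring A] [Algebra R A]

/-- The right module `Hom_A(X, DA)` dual to a left module `X`. -/
abbrev dual (X : ModuleCat.{u} A) : ModuleCat.{u} Aᵐᵒᵖ :=
  ModuleCat.of Aᵐᵒᵖ (X →ₗ[A] DualBimodule R A)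

/-- The dual of an isomorphism. -/
def dualIso {X Y : ModuleCat.{u} A} (e : X ≅ Y) : dual R X ≅ dual R Y where
  hom := ModuleCat.ofHom (LinearMap.lcomp Aᵐᵒᵖ (DualBimodule R A) e.inv.hom)
  inv := ModuleCat.ofHom (LinearMap.lcomp Aᵐᵒᵖ (DualBimodule R A) e.hom.hom)
  hom_inv_id := by
    ext φ : 2
    exact LinearMap.ext fun x => congrArg φ (e.hom_inv_id_apply x)
  inv_hom_id := by
    ext φ : 2
    exact LinearMap.ext fun x => congrArg φ (e.inv_hom_id_apply x)

variable {R}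

theorem IsSES.dual {X Y Z : ModuleCat.{u} A} {f : X ⟶ Y} {g : Y ⟶ Z} (h : IsSES f g) :
    IsSES (X := dual R Z) (Y := dual R Y) (Z := dual R X)
      (ModuleCat.ofHom (LinearMap.lcomp Aᵐᵒᵖ (DualBimodule R A) g.hom))
      (ModuleCat.ofHom (LinearMap.lcomp Aᵐᵒᵖ (DualBimodule R A) f.hom)) := by
  refine IsSES.mk (fun φ ψ hφ => LinearMap.ext fun z => ?_) (fun φ => ⟨fun hφ => ?_, ?_⟩)
    (fun φ => ?_)
  · obtain ⟨y, rfl⟩ := h.surjective z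
    exact LinearMap.congr_fun hφ y
  · obtain ⟨ψ, hψ⟩ := h.exists_factor (T := ModuleCat.of A (DualBimodule R A)) (ModuleCat.ofHom φ)
      (ModuleCat.hom_ext hφ)
    exact ⟨ψ.hom, LinearMap.ext fun y => congrArg (fun k => k.hom y) hψ⟩
  · rintro ⟨ψ, rfl⟩
    refine LinearMap.ext fun x => ?_
    change ψ (g.hom (f.hom x)) = 0
    rw [h.comp_eq_zero, map_zero]
  · exact Module.Injective.extension_property A (DualBimodule R A) X Y f.hom h.injective φ

theorem injective_dual {P : ModuleCat.{u} A} (hP : Projective P) : Injective (dual R P) := by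
  have hP' : Module.Projective A P := (IsProjective.iff_projective P).2 hP
  refine Module.injective_object_of_injective_module Aᵐᵒᵖ _ (inj := ⟨fun X Y _ _ _ _ f hf k => ?_⟩)
  have hsurj : Function.Surjective (LinearMap.lcomp A (DualBimodule R A) f) := fun φ =>
    Module.Injective.extension_property Aᵐᵒᵖ (DualBimodule R A) X Y f hf φ
  obtain ⟨l, hl⟩ := Module.projective_lifting_property _ k.flip hsurj
  refine ⟨l.flip, fun x => LinearMap.ext fun p => ?_⟩
  exact LinearMap.congr_fun (LinearMap.congr_fun hl p) x

theorem IsSyzygy.dual {n : ℕ} {X K : ModuleCat.{u} A} (h : IsSyzygy n X K) :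
    IsCosyzygy n (dual R X) (dual R K) := by
  induction n generalizing K with
  | zero => exact ⟨dualIso R h.some⟩
  | succ n ih =>
    obtain ⟨L, ⟨Q, f, g, hfg, hQ⟩, h⟩ := isSyzygy_succ_iff.1 h
    exact isCosyzygy_succ_iff.2 ⟨_, ⟨_, _, _, hfg.dual, injective_dual hQ⟩, ih h⟩

theorem exists_finite_projStep [IsNoetherianRing A] (M : ModuleCat.{u} A) [Module.Finite A M] :
    ∃ K : ModuleCat.{u} A, ProjStep K M ∧ Module.Finite A K := by
  obtain ⟨n, p, hp⟩ := Module.Finite.exists_fin' A M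
  refine ⟨ModuleCat.of A (LinearMap.ker p), ⟨ModuleCat.of A (Fin n → A), _, _,
    IsSES.mk (LinearMap.ker p).subtype_injective (LinearMap.exact_subtype_ker_map p) hp,
    (IsProjective.iff_projective _).1 inferInstance⟩, ?_⟩
  exact inferInstanceAs (Module.Finite A (LinearMap.ker p))

theorem exists_finite_isSyzygy [IsNoetherianRing A] (n : ℕ) (M : ModuleCat.{u} A)
    [Module.Finite A M] : ∃ K : ModuleCat.{u} A, IsSyzygy n M K ∧ Module.Finite A K := by
  induction n with
  | zero => exact ⟨M, ⟨Iso.refl _⟩, inferInstance⟩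
  | succ n ih =>
    obtain ⟨K, hK, _⟩ := ih
    obtain ⟨L, hL, hL'⟩ := exists_finite_projStep K
    exact ⟨L, isSyzygy_succ_iff.2 ⟨K, hL, hK⟩, hL'⟩

variable [IsArtinianRing R] [Module.Finite R A]

theorem projective_of_injective_dual {K : ModuleCat.{u} A} [Module.Finite A K]
    (h : Injective (dual R K)) : Projective K := by
  obtain ⟨n, p, hp⟩ := Module.Finite.exists_fin' A K
  have hK : Module.Injective Aᵐᵒᵖ (K →ₗ[A] DualBimodule R A) :=
    Module.injective_module_of_injective_object Aᵐᵒᵖ _ (inj := h)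
  obtain ⟨ρ, hρ⟩ := hK.out (LinearMap.lcomp Aᵐᵒᵖ (DualBimodule R A) p)
    (fun φ ψ hφ => LinearMap.ext fun z => by
      obtain ⟨y, rfl⟩ := hp z
      exact LinearMap.congr_fun hφ y) LinearMap.id
  let c : Fin n → DualBimodule R A →ₗ[Aᵐᵒᵖ] ((Fin n → A) →ₗ[A] DualBimodule R A) := fun j =>
    { toFun := fun u => (LinearMap.toSpanSingleton A _ u) ∘ₗ LinearMap.proj j
      map_add' := fun u v => LinearMap.ext fun x => smul_add (x j) u v
      map_smul' := fun b u => LinearMap.ext fun x => smul_comm (x j) b u }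
  have hc : ∀ j u x, c j u x = x j • u := fun _ _ _ => rfl
  have hex : ∀ (k : K) (j : Fin n), ∃ a : A, ∀ u, ρ (c j u) k = a • u := fun k j =>
    DualBimodule.exists_eq_smul
      { toFun := fun u => ρ (c j u) k
        map_add' := fun u v => by rw [map_add, map_add, LinearMap.add_apply]
        map_smul' := fun b u => by rw [map_smul, map_smul]; rfl }
  choose s hs using hex
  have hfaith : ∀ a b : A, (∀ u : DualBimodule R A, a • u = b • u) → a = b := fun a b hab =>
    DualBimodule.eq_of_forall_apply_eq (R := R) fun u => by
      simpa using congrArg (fun v : DualBimodule R A => v 1) (hab u)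
  let s' : K →ₗ[A] (Fin n → A) :=
    { toFun := s
      map_add' := fun k l => funext fun j => hfaith _ _ fun u => by
        rw [Pi.add_apply, add_smul, ← hs, ← hs, ← hs, map_add]
      map_smul' := fun a k => funext fun j => hfaith _ _ fun u => by
        rw [Pi.smul_apply, smul_eq_mul, mul_smul, RingHom.id_apply, ← hs, ← hs, map_smul] }
  have hdec : ∀ φ : K →ₗ[A] DualBimodule R A,
      LinearMap.lcomp Aᵐᵒᵖ (DualBimodule R A) p φ = ∑ j, c j (φ (p (Pi.single j 1))) := fun φ => by
    refine LinearMap.ext fun x => ?_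
    rw [LinearMap.sum_apply]
    change φ (p x) = _
    conv_lhs => rw [pi_eq_sum_univ' x, map_sum, map_sum]
    refine Finset.sum_congr rfl fun j _ => ?_
    rw [map_smul, map_smul, hc]
  have hps : p ∘ₗ s' = LinearMap.id := LinearMap.ext fun k => by
    by_contra hne
    obtain ⟨φ, hφ⟩ := DualBimodule.exists_hom_apply_ne_zero (R := R) (A := A) (sub_ne_zero.2 hne)
    refine hφ ?_
    have h1 : φ k = LinearMap.lcomp Aᵐᵒᵖ (DualBimodule R A) p φ (s' k) := by
      conv_lhs => rw [← LinearMap.id_apply (R := Aᵐᵒᵖ) φ, ← hρ φ]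
      rw [hdec, map_sum, LinearMap.sum_apply, LinearMap.sum_apply]
      exact Finset.sum_congr rfl fun j _ => hs _ _ _
    rw [map_sub, sub_eq_zero, LinearMap.id_apply, h1]
    rfl
  have := Module.Projective.of_split s' p hps
  exact (IsProjective.iff_projective K).1 this

variable (R A) in
theorem injectiveDimension_regular_op_iff (d : ℕ) :
    HasInjectiveDimensionLE (ModuleCat.of Aᵐᵒᵖ A) d ↔
      HasProjectiveDimensionLE (ModuleCat.of A (DualBimodule R A)) d := by
  have : IsNoetherianRing A := isNoetherian_of_tower R inferInstance
  have : Module.Finite A (ModuleCat.of A (DualBimodule R A)) := DualBimodule.finite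
  obtain ⟨K, hK, _⟩ := exists_finite_isSyzygy d (ModuleCat.of A (DualBimodule R A))
  have e : ModuleCat.of Aᵐᵒᵖ A ≅ dual R (ModuleCat.of A (DualBimodule R A)) :=
    (DualBimodule.regularEquiv (R := R) (A := A)).toModuleIso
  rw [hK.projective_iff]
  refine Iff.trans ⟨fun _ => hasInjectiveDimensionLT_of_iso e _,
    fun _ => hasInjectiveDimensionLT_of_iso e.symm _⟩ ((hK.dual (R := R)).injective_iff.trans ?_)
  exact ⟨projective_of_injective_dual, injective_dual⟩

end Duality

section DirectSums

variable {A : Type u} [Ring A]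

theorem injective_finsupp [IsNoetherianRing A] (ι : Type u) (J : Type u) [AddCommGroup J]
    [Module A J] [hJ : Module.Injective A J] : Module.Injective A (ι →₀ J) := by
  classical
  refine Module.Baer.injective fun I g => ?_
  obtain ⟨t, ht⟩ := (inferInstance : Module.Finite A I)
  let s : Finset ι := t.biUnion fun x => (g x).support
  have hs : ∀ x i, i ∉ s → g x i = 0 := fun x i hi => by
    have : x ∈ LinearMap.ker (Finsupp.lapply i ∘ₗ g) := by
      have h1 : Submodule.span A (t : Set I) ≤ LinearMap.ker (Finsupp.lapply i ∘ₗ g) := by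
        refine Submodule.span_le.2 fun y hy => ?_
        refine Finsupp.notMem_support_iff.1 fun h => hi ?_
        exact Finset.mem_biUnion.2 ⟨y, hy, h⟩
      exact h1 (ht ▸ Submodule.mem_top)
    exact this
  have hex : ∀ i, ∃ h : A →ₗ[A] J, ∀ (x : A) (hx : x ∈ I), h x = g ⟨x, hx⟩ i := fun i =>
    (Module.Baer.of_injective hJ) I (Finsupp.lapply i ∘ₗ g)
  choose h hh using hex
  refine ⟨∑ i ∈ s, Finsupp.lsingle i ∘ₗ h i, fun x hx => Finsupp.ext fun i => ?_⟩
  rw [LinearMap.sum_apply, Finsupp.finsetSum_apply]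
  simp only [LinearMap.comp_apply, Finsupp.lsingle_apply, Finsupp.single_apply]
  rw [Finset.sum_ite_eq' s i]
  split_ifs with hi
  · exact hh i x hx
  · exact (hs _ i hi).symm

/-- The direct sum of copies of a module. -/
abbrev copower (ι : Type u) (X : ModuleCat.{u} A) : ModuleCat.{u} A := ModuleCat.of A (ι →₀ X)

theorem IsSES.copower (ι : Type u) {X Y Z : ModuleCat.{u} A} {f : X ⟶ Y} {g : Y ⟶ Z}
    (h : IsSES f g) : IsSES (X := copower ι X) (Y := copower ι Y) (Z := copower ι Z)
      (ModuleCat.ofHom (Finsupp.mapRange.linearMap f.hom))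
      (ModuleCat.ofHom (Finsupp.mapRange.linearMap g.hom)) := by
  refine IsSES.mk (Finsupp.mapRange_injective _ (map_zero _) h.injective)
    (fun φ => ⟨fun hφ => ?_, ?_⟩) (Finsupp.mapRange_surjective _ (map_zero _) h.surjective)
  · have h0 : Function.invFun f.hom 0 = 0 := by
      conv_lhs => rw [← map_zero f.hom]
      exact Function.leftInverse_invFun h.injective 0
    refine ⟨Finsupp.mapRange (Function.invFun f.hom) h0 φ, Finsupp.ext fun i => ?_⟩
    exact Function.invFun_eq ((h.exact (φ i)).1 (DFunLike.congr_fun hφ i))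
  · rintro ⟨ψ, rfl⟩
    exact Finsupp.ext fun i => h.comp_eq_zero (ψ i)

theorem projective_copower (ι : Type u) {P : ModuleCat.{u} A} (hP : Projective P) :
    Projective (copower ι P) := by
  classical
  have : Module.Projective A P := (IsProjective.iff_projective P).2 hP
  exact (IsProjective.iff_projective (ι →₀ P)).1
    (Module.Projective.of_equiv (finsuppLequivDFinsupp A (M := P)).symm)

theorem injective_copower [IsNoetherianRing A] (ι : Type u) {J : ModuleCat.{u} A}
    (hJ : Injective J) : Injective (copower ι J) := by
  have : Module.Injective A J := Module.injective_module_of_injective_object A J (inj := hJ)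
  exact Module.injective_object_of_injective_module A _ (inj := injective_finsupp ι J)

/-- Isomorphic modules have isomorphic direct sums of copies. -/
def copowerIso (ι : Type u) {X Y : ModuleCat.{u} A} (e : X ≅ Y) : copower ι X ≅ copower ι Y :=
  (Finsupp.mapRange.linearEquiv (α := ι) e.toLinearEquiv).toModuleIso

theorem IsSyzygy.copower (ι : Type u) {n : ℕ} {X K : ModuleCat.{u} A} (h : IsSyzygy n X K) :
    IsSyzygy n (copower ι X) (copower ι K) := by
  induction n generalizing K with
  | zero => exact ⟨copowerIso ι h.some⟩
  | succ n ih =>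
    obtain ⟨L, ⟨Q, f, g, hfg, hQ⟩, h⟩ := isSyzygy_succ_iff.1 h
    exact isSyzygy_succ_iff.2 ⟨_, ⟨_, _, _, hfg.copower ι, projective_copower ι hQ⟩, ih h⟩

theorem IsCosyzygy.copower [IsNoetherianRing A] (ι : Type u) {n : ℕ} {X K : ModuleCat.{u} A}
    (h : IsCosyzygy n X K) : IsCosyzygy n (copower ι X) (copower ι K) := by
  induction n generalizing K with
  | zero => exact ⟨copowerIso ι h.some⟩
  | succ n ih =>
    obtain ⟨L, ⟨Q, f, g, hfg, hQ⟩, h⟩ := isCosyzygy_succ_iff.1 h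
    exact isCosyzygy_succ_iff.2 ⟨_, ⟨_, _, _, hfg.copower ι, injective_copower ι hQ⟩, ih h⟩

theorem projectiveDimension_copower (ι : Type u) {X : ModuleCat.{u} A} {d : ℕ}
    (h : HasProjectiveDimensionLE X d) : HasProjectiveDimensionLE (copower ι X) d := by
  obtain ⟨K, hK⟩ := exists_isSyzygy d X
  exact (hK.copower ι).projective_iff.2 (projective_copower ι (hK.projective_iff.1 h))

theorem injectiveDimension_copower [IsNoetherianRing A] (ι : Type u) {X : ModuleCat.{u} A} {d : ℕ}
    (h : HasInjectiveDimensionLE X d) : HasInjectiveDimensionLE (copower ι X) d := by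
  obtain ⟨K, hK⟩ := exists_isCosyzygy d X
  exact (hK.copower ι).injective_iff.2 (injective_copower ι (hK.injective_iff.1 h))

theorem projectiveDimension_of_retract {X Y : ModuleCat.{u} A} (r : Retract X Y) {d : ℕ}
    (h : HasProjectiveDimensionLE Y d) : HasProjectiveDimensionLE X d :=
  r.hasProjectiveDimensionLT _

theorem injectiveDimension_of_retract {X Y : ModuleCat.{u} A} (r : Retract X Y) {d : ℕ}
    (h : HasInjectiveDimensionLE Y d) : HasInjectiveDimensionLE X d :=
  r.hasInjectiveDimensionLT _

/-- A projective module is a direct summand of a free module. -/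
theorem exists_retract_copower_regular (P : ModuleCat.{u} A) (hP : Projective P) :
    ∃ ι : Type u, Nonempty (Retract P (copower ι (ModuleCat.of A A))) := by
  have : Module.Projective A P := (IsProjective.iff_projective P).2 hP
  obtain ⟨s, hs⟩ := Module.projective_def'.1 this
  exact ⟨P, ⟨⟨ModuleCat.ofHom s, ModuleCat.ofHom (Finsupp.linearCombination A id),
    ModuleCat.hom_ext hs⟩⟩⟩

theorem ext_copower_left (ι : Type u) {X Y : ModuleCat.{u} A} {i : ℕ} (hi : 1 ≤ i)
    (h : ∀ i : ℕ, 1 ≤ i → Subsingleton (Abelian.Ext X Y i)) :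
    Subsingleton (Abelian.Ext (copower ι X) Y i) := by
  induction i, hi using Nat.le_induction generalizing Y with
  | base =>
    obtain ⟨C, J, f, g, hfg, hJ⟩ := exists_injStep Y
    refine ext_one_of_exists_lift hfg.2 hJ fun φ => ?_
    have hex : ∀ i : ι, ∃ ψ : X ⟶ J, ψ ≫ g = ModuleCat.ofHom (Finsupp.lsingle i) ≫ φ := fun i =>
      exists_lift_of_ext_one hfg.2 (h 1 le_rfl) _
    choose ψ hψ using hex
    refine ⟨ModuleCat.ofHom (Finsupp.lsum ℕ fun i => (ψ i).hom), ModuleCat.hom_ext ?_⟩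
    refine Finsupp.lhom_ext' fun i => LinearMap.ext fun x => ?_
    have := congrArg (fun k => k.hom x) (hψ i)
    simpa using this
  | succ i hi ih =>
    obtain ⟨C, hC⟩ := exists_injStep Y
    rw [← hC.ext_iff _ hi]
    exact ih fun j hj => (hC.ext_iff X hj).2 (h (j + 1) (by omega))

theorem ext_pi_right (ι : Type u) {X Y : ModuleCat.{u} A} {i : ℕ} (hi : 1 ≤ i)
    (h : ∀ i : ℕ, 1 ≤ i → Subsingleton (Abelian.Ext X Y i)) :
    Subsingleton (Abelian.Ext X (ModuleCat.of A (ι → Y)) i) := by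
  induction i, hi using Nat.le_induction generalizing X with
  | base =>
    obtain ⟨K, P, f, g, hfg, hP⟩ := exists_projStep X
    refine ext_one_of_exists_extension hfg.2 hP fun φ => ?_
    have hex : ∀ i : ι, ∃ ψ : P ⟶ Y, f ≫ ψ = φ ≫ ModuleCat.ofHom (LinearMap.proj i) := fun i =>
      exists_extension_of_ext_one hfg.2 (h 1 le_rfl) _
    choose ψ hψ using hex
    refine ⟨ModuleCat.ofHom (LinearMap.pi fun i => (ψ i).hom), ModuleCat.hom_ext ?_⟩
    refine LinearMap.ext fun x => funext fun i => ?_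
    exact congrArg (fun k => k.hom x) (hψ i)
  | succ i hi ih =>
    obtain ⟨K, hK⟩ := exists_projStep X
    rw [← hK.ext_iff _ hi]
    exact ih fun j hj => (hK.ext_iff Y hj).2 (h (j + 1) (by omega))

end DirectSums

section ArtinianEmbedding

variable (R : Type u) {A : Type u} [CommRing R] [Ring A] [Algebra R A]

theorem exists_simple_le [IsArtinianRing A] {M : Type u} [AddCommGroup M] [Module A M]
    {N : Submodule A M} (hN : N ≠ ⊥) : ∃ S ≤ N, IsSimpleModule A S := by
  obtain ⟨x, hx, hx0⟩ := Submodule.exists_mem_ne_zero_of_ne_bot hN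
  have hat : IsAtomic (Submodule A (Submodule.span A {x})) :=
    isAtomic_of_orderBot_wellFounded_lt wellFounded_lt
  rcases hat.eq_bot_or_exists_atom_le (⊤ : Submodule A (Submodule.span A {x})) with h | ⟨S, hS, -⟩
  · refine absurd ?_ hx0
    have : (⟨x, Submodule.mem_span_singleton_self x⟩ : Submodule.span A {x}) ∈
      (⊤ : Submodule A (Submodule.span A {x})) := trivial
    rw [h, Submodule.mem_bot] at this
    exact congrArg Subtype.val this
  · refine ⟨S.map (Submodule.span A {x}).subtype, (Submodule.map_subtype_le _ _).trans
      ((Submodule.span_singleton_le_iff_mem _ _).2 hx), ?_⟩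
    have : IsSimpleModule A S := isSimpleModule_iff_isAtom.2 hS
    exact IsSimpleModule.congr
      (Submodule.equivMapOfInjective _ (Submodule.span A {x}).injective_subtype S).symm

theorem exists_injective_semisimple (S : Type u) [AddCommGroup S] [Module A S]
    [IsSemisimpleModule A S] :
    ∃ (ι : Type u) (f : S →ₗ[A] (ι →₀ DualBimodule R A)), Function.Injective f := by
  classical
  obtain ⟨s, e, -, hs⟩ := IsSemisimpleModule.exists_linearEquiv_dfinsupp A S
  have hex : ∀ m : s, ∃ f : m.1 →ₗ[A] DualBimodule R A, Function.Injective f := fun m => by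
    have := hs m
    have := IsSimpleModule.nontrivial A m.1
    obtain ⟨x, hx⟩ := exists_ne (0 : m.1)
    obtain ⟨f, hf⟩ := DualBimodule.exists_hom_apply_ne_zero (R := R) (A := A) hx
    exact ⟨f, (LinearMap.injective_or_eq_zero f).resolve_right fun h => hf (by rw [h]; rfl)⟩
  choose f hf using hex
  refine ⟨s, (finsuppLequivDFinsupp A (M := DualBimodule R A)).symm.toLinearMap ∘ₗ
    DFinsupp.mapRange.linearMap f ∘ₗ e.toLinearMap, ?_⟩
  exact (finsuppLequivDFinsupp A (M := DualBimodule R A)).symm.injective.comp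
    (((DFinsupp.mapRange_injective (hf := fun _ => map_zero _)).2 hf).comp e.injective)

/-- Every module over an artin algebra embeds in a direct sum of copies of `DA`. -/
theorem exists_injective_copower [IsArtinianRing A] [IsNoetherianRing A] (M : Type u)
    [AddCommGroup M] [Module A M] :
    ∃ (ι : Type u) (f : M →ₗ[A] (ι →₀ DualBimodule R A)), Function.Injective f := by
  let T : Submodule A M := ⨆ m ∈ {m : Submodule A M | IsSimpleModule A m}, m
  have hT : IsSemisimpleModule A T := isSemisimpleModule_biSup_of_isSemisimpleModule_submodule
    fun m (hm : IsSimpleModule A m) => inferInstance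
  obtain ⟨ι, f, hf⟩ := exists_injective_semisimple R (A := A) T
  have := injective_finsupp (A := A) ι (DualBimodule R A)
  obtain ⟨g, hg⟩ := this.out T.subtype T.subtype_injective f
  refine ⟨ι, g, LinearMap.ker_eq_bot.1 ?_⟩
  by_contra hne
  obtain ⟨S, hS, hS'⟩ := exists_simple_le hne
  have := IsSimpleModule.nontrivial A S
  obtain ⟨x, hx⟩ := exists_ne (0 : S)
  have hST : S ≤ T :=
    le_biSup (fun m : Submodule A M => m) (show S ∈ {m : Submodule A M | IsSimpleModule A m} from hS')
  have h0 : f ⟨x, hST x.2⟩ = 0 := (hg _).symm.trans (hS x.2)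
  have h1 : (⟨x, hST x.2⟩ : T) = 0 := hf (h0.trans (map_zero f).symm)
  have h2 : (x : M) = 0 := congrArg (fun y : T => (y : M)) h1
  exact hx (Subtype.ext h2)

theorem exists_retract_copower_dual [IsArtinianRing A] [IsNoetherianRing A] (J : ModuleCat.{u} A)
    (hJ : Injective J) :
    ∃ ι : Type u, Nonempty (Retract J (copower ι (ModuleCat.of A (DualBimodule R A)))) := by
  obtain ⟨ι, f, hf⟩ := exists_injective_copower R (A := A) J
  have := Module.injective_module_of_injective_object A J (inj := hJ)
  obtain ⟨r, hr⟩ := this.out f hf LinearMap.id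
  exact ⟨ι, ⟨⟨ModuleCat.ofHom f, ModuleCat.ofHom r, ModuleCat.hom_ext (LinearMap.ext hr)⟩⟩⟩

end ArtinianEmbedding

/-- Over an artin algebra, a free module is a direct summand of a product of copies of the
algebra. -/
theorem exists_retract_copower_pi (R A : Type u) [CommRing R] [IsArtinianRing R] [Ring A]
    [Algebra R A] [Module.Finite R A] (ι : Type u) :
    Nonempty (Retract (copower ι (ModuleCat.of A A)) (ModuleCat.of A (ι → ModuleCat.of A A))) := by
  have hE := (isMinimalInjectiveCogenerator_minInjCogenerator R).isInjective
  obtain ⟨p, hp⟩ := (injective_finsupp (A := R) ι (minInjCogenerator R)).out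
    (Finsupp.lcoeFun : (ι →₀ minInjCogenerator R) →ₗ[R] ι → minInjCogenerator R)
    DFunLike.coe_injective LinearMap.id
  have hfl := DualBimodule.isFiniteLength_of_finite (R := R) A
  have hsep : ∀ a b : A, (∀ v : A →ₗ[R] minInjCogenerator R, v a = v b) → a = b := fun a b h =>
    (matlis_bijective hfl).1 (LinearMap.ext h)
  have hex : ∀ (x : ι → A) (i : ι), ∃ a : A, ∀ v : A →ₗ[R] minInjCogenerator R,
      v a = p (fun j => v (x j)) i := fun x i => by
    obtain ⟨a, ha⟩ := (matlis_bijective hfl).2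
      (Finsupp.lapply i ∘ₗ p ∘ₗ LinearMap.pi fun j => LinearMap.applyₗ (x j))
    exact ⟨a, LinearMap.congr_fun ha⟩
  choose a ha using hex
  have hfin : ∀ x, (Function.support (a x)).Finite := fun x => by
    have := (isFiniteLength_iff_isNoetherian_isArtinian.1 (isFiniteLength_hom hfl)).1
    obtain ⟨t, ht⟩ := (inferInstance : Module.Finite R (A →ₗ[R] minInjCogenerator R))
    refine (t.finite_toSet.biUnion fun v _ => (p fun j => v (x j)).hasFiniteSupport).subset
      fun i hi => ?_
    by_contra hne
    refine hi (hsep _ _ fun v => ?_)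
    have h1 : Submodule.span R (t : Set (A →ₗ[R] minInjCogenerator R)) ≤
        LinearMap.ker (LinearMap.applyₗ (a x i)) := Submodule.span_le.2 fun v hv => by
      by_contra h0
      refine hne (Set.mem_biUnion hv ?_)
      rw [Function.mem_support, ← ha]
      exact h0
    have h2 : v (a x i) = 0 := h1 (ht ▸ Submodule.mem_top)
    rw [h2, map_zero]
  let ρ : (ι → A) →ₗ[A] (ι →₀ A) :=
    { toFun := fun x => Finsupp.ofSupportFinite (a x) (hfin x)
      map_add' := fun x y => Finsupp.ext fun i => hsep _ _ fun v => by
        change v (a (x + y) i) = v (a x i + a y i)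
        rw [map_add, ha, ha, ha, ← Finsupp.add_apply, ← map_add]
        exact congrArg (fun z => p z i) (funext fun j => map_add v _ _)
      map_smul' := fun b x => Finsupp.ext fun i => hsep _ _ fun v => by
        change v (a (b • x) i) = (v ∘ₗ LinearMap.mulLeft R b) (a x i)
        rw [ha, ha]
        rfl }
  refine ⟨⟨ModuleCat.ofHom Finsupp.lcoeFun, ModuleCat.ofHom ρ, ModuleCat.hom_ext ?_⟩⟩
  refine LinearMap.ext fun y => Finsupp.ext fun i => hsep _ _ fun v => ?_
  change v (a y i) = v (y i)
  rw [ha]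
  exact DFunLike.congr_fun (hp (Finsupp.mapRange v (map_zero v) y)) i

theorem projPerp_eq_leftPerp (R A : Type u) [CommRing R] [IsArtinianRing R] [Ring A]
    [Algebra R A] [Module.Finite R A] :
    projPerp A = leftPerp A (ModuleCat.of A A) := by
  ext M
  refine ⟨fun h i hi => h _ ((IsProjective.iff_projective A).1 inferInstance) i hi,
    fun h P hP i hi => ?_⟩
  obtain ⟨ι, ⟨r⟩⟩ := exists_retract_copower_regular P hP
  obtain ⟨r'⟩ := exists_retract_copower_pi R A ι
  exact subsingleton_ext_of_retract_right r
    (subsingleton_ext_of_retract_right r' (ext_pi_right ι hi h))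

theorem injective_dualBimodule (R A : Type u) [CommRing R] [Ring A] [Algebra R A] :
    Injective (ModuleCat.of A (DualBimodule R A)) :=
  Module.injective_object_of_injective_module A _

theorem injPerp_eq_rightPerp (R A : Type u) [CommRing R] [IsArtinianRing R] [Ring A]
    [Algebra R A] [Module.Finite R A] :
    injPerp A = rightPerp A (dualModule R A) := by
  have : IsNoetherianRing A := isNoetherian_of_tower R inferInstance
  have : IsArtinianRing A := isArtinian_of_tower R inferInstance
  have e : dualModule R A ≅ ModuleCat.of A (DualBimodule R A) :=
    (dualModuleEquiv R A).toModuleIso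
  ext M
  refine ⟨fun h i hi => subsingleton_ext_of_retract_left e.retract
    (h _ (injective_dualBimodule R A) i hi), fun h J hJ i hi => ?_⟩
  obtain ⟨ι, ⟨r⟩⟩ := exists_retract_copower_dual R J hJ
  exact subsingleton_ext_of_retract_left r (ext_copower_left ι hi fun j hj =>
    subsingleton_ext_of_retract_left e.symm.retract (h j hj))

/-- An artin algebra is `d`-Gorenstein exactly if all projective modules have injective dimension
at most `d` and all injective modules have projective dimension at most `d`. -/
theorem isGorensteinLE_iff (R A : Type u) [CommRing R] [IsArtinianRing R] [Ring A]
    [Algebra R A] [Module.Finite R A] (d : ℕ) : IsGorensteinLE A d ↔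
    (∀ P : ModuleCat.{u} A, Projective P → HasInjectiveDimensionLE P d) ∧
      ∀ I : ModuleCat.{u} A, Injective I → HasProjectiveDimensionLE I d := by
  have : IsNoetherianRing A := isNoetherian_of_tower R inferInstance
  have : IsArtinianRing A := isArtinian_of_tower R inferInstance
  rw [IsGorensteinLE, injectiveDimension_regular_op_iff R A]
  refine and_congr ⟨fun h P hP => ?_, fun h => h _ ((IsProjective.iff_projective A).1 inferInstance)⟩
    ⟨fun h I hI => ?_, fun h => h _ (injective_dualBimodule R A)⟩
  · obtain ⟨ι, ⟨r⟩⟩ := exists_retract_copower_regular P hP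
    exact injectiveDimension_of_retract r (injectiveDimension_copower ι h)
  · obtain ⟨ι, ⟨r⟩⟩ := exists_retract_copower_dual R I hI
    exact projectiveDimension_of_retract r (projectiveDimension_copower ι h)

end GorensteinArtin

end

open GorensteinArtin

theorem mainTheorem2 (R A : Type u) [CommRing R] [IsArtinianRing R] [Ring A] [Algebra R A]
    [Module.Finite R A] (d : ℕ) :
    List.TFAE [
      GorensteinArtin.IsGorensteinLE A d,
      GorensteinArtin.GProj A = GorensteinArtin.syzygies A d,
      GorensteinArtin.GInj A = GorensteinArtin.cosyzygies A d] ∧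
    (GorensteinArtin.IsGorensteinLE A d →
      GorensteinArtin.GProj A = GorensteinArtin.leftPerp A (ModuleCat.of A A) ∧
      GorensteinArtin.GInj A = GorensteinArtin.rightPerp A (GorensteinArtin.dualModule R A) ∧
      GorensteinArtin.IsCotorsionPair (GorensteinArtin.GProj A) (GorensteinArtin.projDimLE A d) ∧
      GorensteinArtin.IsCotorsionPair (GorensteinArtin.injDimLE A d) (GorensteinArtin.GInj A)) := by
  have key := isGorensteinLE_iff R A d
  refine ⟨?_, fun h => ?_⟩
  · tfae_have 1 → 2 := fun h => gproj_eq_syzygies (key.1 h).1 (key.1 h).2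
    tfae_have 1 → 3 := fun h => ginj_eq_cosyzygies (key.1 h).1 (key.1 h).2
    tfae_have 2 → 1 := fun h => key.2 ⟨injectiveDimension_of_gproj_eq_syzygies h,
      projectiveDimension_of_gproj_eq_syzygies h⟩
    tfae_have 3 → 1 := fun h => key.2 ⟨injectiveDimension_of_ginj_eq_cosyzygies h,
      projectiveDimension_of_ginj_eq_cosyzygies h⟩
    tfae_finish
  · obtain ⟨hP, hI⟩ := key.1 h
    exact ⟨(gproj_eq_projPerp hP hI).trans (projPerp_eq_leftPerp R A),
      (ginj_eq_injPerp hP hI).trans (injPerp_eq_rightPerp R A),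
      isCotorsionPair_gproj hP hI, isCotorsionPair_ginj hP hI⟩
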